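/- Let $K$ be an algebraically closed field of characteristic zero and let $\ell$ be a finite-dimensional semisimple Lie algebra over $K$, with basis $\{u\}$ and dual basis $\{u'\}$ of $\ell'=\mathrm{Hom}(\ell,K)$. Let $\phi:\ell\to\ell'$ be the isomorphism given by the Killing form (or by any fixed nonzero scalar multiple of it). Consider the Clifford algebra generated by symbols $b_n^x, c_n^{f}$ and the Weyl algebra generated by symbols $\beta_n^x,\gamma_n^{f}$ ($n\in\mathbb Z$; linear in $x\in\ell$, $f\in\ell'$), with relations $$c_n^{f}b_m^x+b_m^xc_n^{f}=\langle f,x\rangle\delta_{m+n,0},\qquad \gamma_n^{f}\beta_m^x-\beta_m^x\gamma_n^{f}=\langle f,x\rangle\delta_{m+n,0},$$ where the $b$'s anticommute with each other, the $c$'s anticommute with each other, the $\beta$'s commute with each other and the $\gamma$'s commute with each other. The creation operators are $b_n^x,\beta_n^x$ with $n\le -1$ and $c_n^{f},\gamma_n^{f}$ with $n\le 0$; all other generators are annihilation operators. Let $W=S\otimes\Lambda$, where $S$ (resp. $\Lambda$) is the module over the Weyl (resp. Clifford) algebra induced from the trivial one-dimensional representation of the subalgebra generated by its annihilation operators. Normal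 ordering $:\ :$ moves annihilation operators to the right, with a sign $-1$ for each interchange of two odd generators ($b$'s and $c$'s are odd, $\beta$'s and $\gamma$'s even). The superdegree is the number of $c$'s minus the number of $b$'s, and $[A,B]$ is $AB+BA$ if $A$ and $B$ both have odd superdegree and $AB-BA$ otherwise. For $x\in\ell$ and $n\in\mathbb Z$ put $$L_n=-\sum_{u,m}m:b_{n+m}^uc_{-m}^{u'}:-\sum_{u,m}m:\beta_{n+m}^u\gamma_{-m}^{u'}:,\qquad \theta(x_n)=\sum_{v,m}:\beta_{n+m}^{[x,v]}\gamma_{-m}^{v'}:+\sum_{v,m}:b_{n+m}^{[x,v]}c_{-m}^{v'}:,$$ $$Q=\sum_{u,v;i,j}:\beta_{i+j}^{[u,v]}\gamma_{-i}^{v'}c_{-j}^{u'}:+\tfrac12\sum_{u,v;i,j}:b_{i+j}^{[u,v]}c_{-i}^{v'}c_{-j}^{u'}:,$$ $$h=\sum_{u,n}\gamma_{-n}^{u'}b_n^u,\qquad k=\sum_{u,n}n\,\beta_n^uc_{-n}^{u'},\qquad r=\sum_{u,n}n\,\gamma_{-n}^{\phi(u)}c_n^{u'},\qquad t=\sum_{u,n}\beta_{-n}^{\phi^{-1}(u')}b_n^u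 .$$ Then these infinite sums are well-defined operators on $W$ (every vector is killed by all but finitely many terms), and 1. $r^2=t^2=0$; 2. $[r,t]=-L_0$; 3. $[Q,r]=[Q,t]=0$; 4. $[r,h]=[r,k]=[t,h]=[t,k]=0$; 5. $[t,\theta(x_n)]=0$ for all $x\in\ell$, $n\in\mathbb Z$; 6. $[r,\theta(x_0)]=0$ for all $x\in\ell$; 7. $[r,L_n]=0$ for all $n\in\mathbb Z$; 8. $[t,L_0]=0$. -/

import Mathlib

open scoped TensorProduct

noncomputable section

namespace VOWA

section Algebras

variable (K ℓ : Type*) [Field K] [LieRing ℓ] [LieAlgebra K ℓ]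

/-- The loop space `ℓ ⊗ K[t, t⁻¹]` (the finitely supported function `Finsupp.single n x` is
`x ⊗ t ^ n`) together with its restricted dual (`Finsupp.single n f` is `f` viewed as a functional
on `ℓ ⊗ t ^ (-n)`). -/
def ModeSpace : Type _ := (ℤ →₀ ℓ) × (ℤ →₀ Module.Dual K ℓ)

instance : AddCommGroup (ModeSpace K ℓ) :=
  inferInstanceAs (AddCommGroup ((ℤ →₀ ℓ) × (ℤ →₀ Module.Dual K ℓ)))

instance : Module K (ModeSpace K ℓ) :=
  inferInstanceAs (Module K ((ℤ →₀ ℓ) × (ℤ →₀ Module.Dual K ℓ)))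

/-- The component of a vector of the mode space in the loop space. -/
def loopPart : ModeSpace K ℓ →ₗ[K] (ℤ →₀ ℓ) :=
  LinearMap.fst K (ℤ →₀ ℓ) (ℤ →₀ Module.Dual K ℓ)

/-- The component of a vector of the mode space in the restricted dual. -/
def dualPart : ModeSpace K ℓ →ₗ[K] (ℤ →₀ Module.Dual K ℓ) :=
  LinearMap.snd K (ℤ →₀ ℓ) (ℤ →₀ Module.Dual K ℓ)

variable {K ℓ} in
/-- The vector `x ⊗ t ^ n` of the loop space. -/
def loopMode (n : ℤ) (x : ℓ) : ModeSpace K ℓ := (Finsupp.single n x, 0)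

variable {K ℓ} in
/-- The functional `f` placed in mode number `n`, that is, living on `ℓ ⊗ t ^ (-n)`. -/
def dualMode (n : ℤ) (f : Module.Dual K ℓ) : ModeSpace K ℓ := (0, Finsupp.single n f)

/-- The pairing of the restricted dual with the loop space: `∑ₙ fₙ (x₋ₙ)`. -/
def pairing : (ℤ →₀ Module.Dual K ℓ) →ₗ[K] (ℤ →₀ ℓ) →ₗ[K] K :=
  Finsupp.lsum K fun n => LinearMap.lcomp K K (Finsupp.lapply (-n))

/-- The bilinear form `((x, f), (y, g)) ↦ ⟨f, y⟩` on the mode space. -/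
def halfForm : LinearMap.BilinForm K (ModeSpace K ℓ) :=
  (pairing K ℓ).compl₁₂ (dualPart K ℓ) (loopPart K ℓ)

/-- The quadratic form `(x, f) ↦ ⟨f, x⟩`. -/
def quadForm : QuadraticForm K (ModeSpace K ℓ) :=
  LinearMap.BilinMap.toQuadraticMap (halfForm K ℓ)

/-- The alternating form `((x, f), (y, g)) ↦ ⟨f, y⟩ - ⟨g, x⟩`. -/
def sympForm : LinearMap.BilinForm K (ModeSpace K ℓ) :=
  halfForm K ℓ - (halfForm K ℓ).flip

/-- The Clifford algebra of the loop space and its restricted dual (the `b`'s and `c`'s). -/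
def Cliff : Type _ := CliffordAlgebra (quadForm K ℓ)

instance : Ring (Cliff K ℓ) :=
  inferInstanceAs (Ring (CliffordAlgebra (quadForm K ℓ)))

instance : Algebra K (Cliff K ℓ) :=
  inferInstanceAs (Algebra K (CliffordAlgebra (quadForm K ℓ)))

/-- The canonical map from the mode space to the Clifford algebra. -/
def cliffι : ModeSpace K ℓ →ₗ[K] Cliff K ℓ :=
  CliffordAlgebra.ι (quadForm K ℓ)

/-- The relations `v w - w v = ω (v, w)` of the Weyl algebra. -/
inductive WeylRel : TensorAlgebra K (ModeSpace K ℓ) → TensorAlgebra K (ModeSpace K ℓ) → Prop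
  | comm (v w : ModeSpace K ℓ) : WeylRel
      (TensorAlgebra.ι K v * TensorAlgebra.ι K w)
      (TensorAlgebra.ι K w * TensorAlgebra.ι K v +
        algebraMap K (TensorAlgebra K (ModeSpace K ℓ)) (sympForm K ℓ v w))

/-- The Weyl algebra of the loop space and its restricted dual (the `β`'s and `γ`'s). -/
def Weyl : Type _ := RingQuot (WeylRel K ℓ)

instance : Ring (Weyl K ℓ) := inferInstanceAs (Ring (RingQuot (WeylRel K ℓ)))

instance : Algebra K (Weyl K ℓ) := inferInstanceAs (Algebra K (RingQuot (WeylRel K ℓ)))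

/-- The quotient map from the tensor algebra to the Weyl algebra. -/
def weylMk : TensorAlgebra K (ModeSpace K ℓ) →ₐ[K] Weyl K ℓ :=
  RingQuot.mkAlgHom K (WeylRel K ℓ)

/-- The canonical map from the mode space to the Weyl algebra. -/
def weylι : ModeSpace K ℓ →ₗ[K] Weyl K ℓ :=
  (weylMk K ℓ).toLinearMap ∘ₗ TensorAlgebra.ι K

/-- The annihilation modes: `x ⊗ t ^ n` with `n ≥ 0`, and functionals of mode number `n ≥ 1`. -/
def annihilationModes : Set (ModeSpace K ℓ) :=
  {v | (∃ (n : ℤ) (x : ℓ), 0 ≤ n ∧ v = loopMode n x) ∨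
       (∃ (n : ℤ) (f : Module.Dual K ℓ), 1 ≤ n ∧ v = dualMode n f)}

/-- The left ideal of the Weyl algebra generated by the annihilation operators. -/
def symIdeal : Submodule (Weyl K ℓ) (Weyl K ℓ) :=
  Submodule.span (Weyl K ℓ) (weylι K ℓ '' annihilationModes K ℓ)

/-- The left ideal of the Clifford algebra generated by the annihilation operators. -/
def extIdeal : Submodule (Cliff K ℓ) (Cliff K ℓ) :=
  Submodule.span (Cliff K ℓ) (cliffι K ℓ '' annihilationModes K ℓ)

/-- The semi-infinite symmetric module: the module over the Weyl algebra induced from the trivial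
representation of the subalgebra generated by the annihilation operators, i.e. the quotient of the
Weyl algebra by the left ideal generated by these operators. -/
def SymModule : Type _ := Weyl K ℓ ⧸ symIdeal K ℓ

instance : AddCommGroup (SymModule K ℓ) :=
  inferInstanceAs (AddCommGroup (Weyl K ℓ ⧸ symIdeal K ℓ))

instance : Module K (SymModule K ℓ) :=
  inferInstanceAs (Module K (Weyl K ℓ ⧸ symIdeal K ℓ))

instance : Module (Weyl K ℓ) (SymModule K ℓ) :=
  inferInstanceAs (Module (Weyl K ℓ) (Weyl K ℓ ⧸ symIdeal K ℓ))

instance : IsScalarTower K (Weyl K ℓ) (SymModule K ℓ) :=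
  inferInstanceAs (IsScalarTower K (Weyl K ℓ) (Weyl K ℓ ⧸ symIdeal K ℓ))

/-- The semi-infinite exterior module: the module over the Clifford algebra induced from the
trivial representation of the subalgebra generated by the annihilation operators. -/
def ExtModule : Type _ := Cliff K ℓ ⧸ extIdeal K ℓ

instance : AddCommGroup (ExtModule K ℓ) :=
  inferInstanceAs (AddCommGroup (Cliff K ℓ ⧸ extIdeal K ℓ))

instance : Module K (ExtModule K ℓ) :=
  inferInstanceAs (Module K (Cliff K ℓ ⧸ extIdeal K ℓ))

instance : Module (Cliff K ℓ) (ExtModule K ℓ) :=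
  inferInstanceAs (Module (Cliff K ℓ) (Cliff K ℓ ⧸ extIdeal K ℓ))

instance : IsScalarTower K (Cliff K ℓ) (ExtModule K ℓ) :=
  inferInstanceAs (IsScalarTower K (Cliff K ℓ) (Cliff K ℓ ⧸ extIdeal K ℓ))

/-- The vertex operator Weil algebra (as a vector space). -/
abbrev Space : Type _ := SymModule K ℓ ⊗[K] ExtModule K ℓ

/-- Linear operators on the vertex operator Weil algebra. -/
abbrev Op : Type _ := Module.End K (Space K ℓ)

end Algebras

section Operators

variable {K ℓ : Type*} [Field K] [LieRing ℓ] [LieAlgebra K ℓ]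

/-- The action of the Weyl algebra element attached to `v` (on the symmetric factor). -/
def weylOp (v : ModeSpace K ℓ) : Op K ℓ :=
  LinearMap.rTensor (ExtModule K ℓ) (Algebra.lsmul K K (SymModule K ℓ) (weylι K ℓ v))

/-- The action of the Clifford algebra element attached to `v` (on the exterior factor; the
symmetric factor is purely even, so that no sign occurs). -/
def cliffOp (v : ModeSpace K ℓ) : Op K ℓ :=
  LinearMap.lTensor (SymModule K ℓ)
    (Algebra.lsmul K K (ExtModule K ℓ) (cliffι K ℓ v))

variable (K ℓ) in
/-- The symbols `bₙˣ`, `cₙᶠ`, `βₙˣ`, `γₙᶠ` with `x` in `ℓ` and `f` in the dual of `ℓ`. -/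
inductive Mode : Type _
  | b (n : ℤ) (x : ℓ) : Mode
  | c (n : ℤ) (f : Module.Dual K ℓ) : Mode
  | β (n : ℤ) (x : ℓ) : Mode
  | γ (n : ℤ) (f : Module.Dual K ℓ) : Mode

/-- The operator given by a symbol. -/
def Mode.op : Mode K ℓ → Op K ℓ
  | .b n x => cliffOp (loopMode n x)
  | .c n f => cliffOp (dualMode n f)
  | .β n x => weylOp (loopMode n x)
  | .γ n f => weylOp (dualMode n f)

/-- The creation operators: `bₙ`, `βₙ` with `n ≤ -1` and `cₙ`, `γₙ` with `n ≤ 0`. The other symbols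
are annihilation operators. -/
def Mode.isCreation : Mode K ℓ → Bool
  | .b n _ => decide (n ≤ -1)
  | .c n _ => decide (n ≤ 0)
  | .β n _ => decide (n ≤ -1)
  | .γ n _ => decide (n ≤ 0)

/-- The `b`'s and `c`'s are odd, the `β`'s and `γ`'s are even. -/
def Mode.isOdd : Mode K ℓ → Bool
  | .b _ _ => true
  | .c _ _ => true
  | .β _ _ => false
  | .γ _ _ => false

/-- The normally ordered product of a string of symbols: annihilation operators are moved to the
right, with the sign `-1` for each interchange of two odd symbols. -/
def normalProd : List (Mode K ℓ) → Op K ℓ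
  | [] => 1
  | m :: l =>
      if m.isCreation then m.op * normalProd l
      else (if m.isOdd then (-1 : K) ^ (l.countP Mode.isOdd) else 1) • (normalProd l * m.op)

/-- A family of operators is locally finite if every vector is killed by all but finitely many of
its members. -/
def LocallyFinite {I : Type*} (f : I → Op K ℓ) : Prop :=
  ∀ w : Space K ℓ, (Function.support fun i => f i w).Finite

open Classical in
/-- The sum of a locally finite family of operators, `w ↦ ∑ᵢ fᵢ w` (and `0` if the family is not
locally finite). -/
def opSum {I : Type*} (f : I → Op K ℓ) : Op K ℓ :=
  if h : LocallyFinite f then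
    { toFun := fun w => ∑ᶠ i, f i w
      map_add' := fun v w => by
        simp only [map_add]
        exact finsum_add_distrib (h v) (h w)
      map_smul' := fun a w => by
        simp only [map_smul, RingHom.id_apply]
        exact (smul_finsum' a (h w)).symm }
  else 0

/-- The supercommutator of operators `A`, `B` of superdegrees `p`, `q` (the number of `c`'s minus
the number of `b`'s): the anticommutator if both are odd, the commutator otherwise. -/
def superComm (p q : ℤ) (A B : Op K ℓ) : Op K ℓ :=
  if Odd p ∧ Odd q then A * B + B * A else A * B - B * A

variable {ι : Type*} (B : Module.Basis ι K ℓ)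

/-- The terms `-m :b_{n+m}^u c_{-m}^{u'}: - m :β_{n+m}^u γ_{-m}^{u'}:` of `Lₙ`. -/
def virTerm (n : ℤ) (p : ι × ℤ) : Op K ℓ :=
  -((p.2 : K) • normalProd [.b (n + p.2) (B p.1), .c (-p.2) (B.coord p.1)]) -
    (p.2 : K) • normalProd [.β (n + p.2) (B p.1), .γ (-p.2) (B.coord p.1)]

/-- The Virasoro operator `Lₙ` (superdegree `0`). -/
def virOp (n : ℤ) : Op K ℓ := opSum (virTerm B n)

/-- The terms `:β_{n+m}^{[x,v]} γ_{-m}^{v'}: + :b_{n+m}^{[x,v]} c_{-m}^{v'}:` of `θ(xₙ)`. -/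
def thetaTerm (x : ℓ) (n : ℤ) (p : ι × ℤ) : Op K ℓ :=
  normalProd [.β (n + p.2) ⁅x, B p.1⁆, .γ (-p.2) (B.coord p.1)] +
    normalProd [.b (n + p.2) ⁅x, B p.1⁆, .c (-p.2) (B.coord p.1)]

/-- The action `θ(xₙ)` of the element `xₙ = x ⊗ t ^ n` of the loop algebra (superdegree `0`). -/
def thetaOp (x : ℓ) (n : ℤ) : Op K ℓ := opSum (thetaTerm B x n)

/-- The terms of `Q`, indexed by basis elements `u`, `v` and integers `i`, `j`. The factor `1 / 2`
expresses that the second sum runs over unordered pairs of basis elements of the loop algebra. -/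
def diffTerm (p : (ι × ι) × (ℤ × ℤ)) : Op K ℓ :=
  let u := p.1.1
  let v := p.1.2
  let i := p.2.1
  let j := p.2.2
  normalProd [.β (i + j) ⁅B u, B v⁆, .γ (-i) (B.coord v), .c (-j) (B.coord u)] +
    (1 / 2 : K) •
      normalProd [.b (i + j) ⁅B u, B v⁆, .c (-i) (B.coord v), .c (-j) (B.coord u)]

/-- The semi-infinite cohomology differential `Q` (superdegree `1`). -/
def diffOp : Op K ℓ := opSum (diffTerm B)

/-- The terms `γ_{-n}^{u'} b_n^u` of `h`. -/
def koszulTerm (p : ι × ℤ) : Op K ℓ :=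
  (Mode.γ (-p.2) (B.coord p.1)).op * (Mode.b p.2 (B p.1)).op

/-- The semi-infinite Koszul differential `h` (superdegree `-1`). -/
def koszulOp : Op K ℓ := opSum (koszulTerm B)

/-- The terms `n β_n^u c_{-n}^{u'}` of `k`. -/
def homotopyTerm (p : ι × ℤ) : Op K ℓ :=
  (p.2 : K) • ((Mode.β p.2 (B p.1)).op * (Mode.c (-p.2) (B.coord p.1)).op)

/-- The homotopy operator `k` (superdegree `1`). -/
def homotopyOp : Op K ℓ := opSum (homotopyTerm B)

variable (φ : ℓ ≃ₗ[K] Module.Dual K ℓ)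

/-- The terms `n γ_{-n}^{φ(u)} c_n^{u'}` of `r`. -/
def rTerm (p : ι × ℤ) : Op K ℓ :=
  (p.2 : K) • ((Mode.γ (-p.2) (φ (B p.1))).op * (Mode.c p.2 (B.coord p.1)).op)

/-- The operator `r` (superdegree `1`). -/
def rOp : Op K ℓ := opSum (rTerm B φ)

/-- The terms `β_{-n}^{φ⁻¹(u')} b_n^u` of `t`. -/
def tTerm (p : ι × ℤ) : Op K ℓ :=
  (Mode.β (-p.2) (φ.symm (B.coord p.1))).op * (Mode.b p.2 (B p.1)).op

/-- The operator `t` (superdegree `-1`). -/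
def tOp : Op K ℓ := opSum (tTerm B φ)

end Operators

/-- The isomorphism `x ↦ a • κ(x, ·)` from a semisimple Lie algebra in characteristic zero to its
dual, where `κ` is the Killing form and `a` is a nonzero scalar (a choice of normalization). -/
def killingIso (K ℓ : Type*) [Field K] [CharZero K] [LieRing ℓ] [LieAlgebra K ℓ]
    [FiniteDimensional K ℓ] [LieAlgebra.HasTrivialRadical K ℓ] (a : Kˣ) :
    ℓ ≃ₗ[K] Module.Dual K ℓ :=
  (LinearMap.BilinForm.toDual (killingForm K ℓ)
    (LieAlgebra.IsKilling.killingForm_nondegenerate K ℓ)).trans (LinearEquiv.smulOfUnit a)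

end VOWA

end

/-! The vacuum is cyclic for the symbols `b`, `c`, `β`, `γ`. An operator that supercommutes with all
symbols and kills the vacuum is therefore zero (`eq_zero_of_superBracket`), and an identity between
operators can be tested on symbols and on the vacuum.

The operators `h`, `k`, `r`, `t`, `L_n`, `θ(x_n)` are quadratic, so their brackets with a symbol are
again single symbols: the contraction selects one mode, and the sum over dual bases collapses. Given
these brackets, every relation among quadratic operators follows from the super Jacobi identity on
symbols. About `φ` only two facts are needed: symmetry, `φ x y = φ y x`, and invariance, `φ x ∘ ad y
= φ ⁅x, y⁆`.

For `n < 0` the operators `L_n` and `θ(x_n)` need not kill the vacuum. There the grading by `L_0`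
replaces the vacuum test. An operator supercommuting with all symbols commutes with `L_0`, which is
a sum of products of symbols; if it has weight `n ≠ 0` it must vanish in characteristic zero
(`HasWeight.eq_zero`).

The differential `Q` is cubic. Its brackets with symbols are quadratic, notably `[Q, b_n^x] =
θ(x_n)` (`diffOp_b`), and its double brackets with symbols are single symbols or zero. For `X = [Q,
r]` or `X = [Q, t]` the criterion is applied twice: to `X`, and before that to each bracket of `X`
with a symbol. The remaining weight zero cases for `t` are settled by evaluation on the vacuum,
where the symmetric form `φ⁻¹` is paired with the antisymmetric Lie bracket. -/

noncomputable section

namespace VOWA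

/-! ### Supercommutators in an associative algebra. -/

section SuperBracket

variable {K R : Type*} [Field K] [Ring R] [Algebra K R]

variable (K) in
/-- The sign `-1` if both parities are odd, and `1` otherwise. -/
def parSign (p q : Bool) : K := bif p && q then -1 else 1

variable (K R) in
/-- The supercommutator of elements of parities `p` and `q` (`true` is odd), as a bilinear map. -/
def superBracket (p q : Bool) : R →ₗ[K] R →ₗ[K] R :=
  LinearMap.mul K R - parSign K p q • (LinearMap.mul K R).flip

theorem superBracket_apply (p q : Bool) (a b : R) :
    superBracket K R p q a b = a * b - parSign K p q • (b * a) := rfl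

@[simp] theorem parSign_true : parSign K true true = -1 := rfl
@[simp] theorem parSign_false_left (q : Bool) : parSign K false q = 1 := by cases q <;> rfl
@[simp] theorem parSign_false_right (q : Bool) : parSign K q false = 1 := by cases q <;> rfl

theorem parSign_comm (p q : Bool) : parSign K p q = parSign K q p := by
  cases p <;> cases q <;> rfl

theorem parSign_mul_self (p q : Bool) : parSign K p q * parSign K p q = 1 := by
  cases p <;> cases q <;> simp

theorem parSign_xor_left (p q r : Bool) :
    parSign K (p ^^ q) r = parSign K p r * parSign K q r := by
  cases p <;> cases q <;> cases r <;> simp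

theorem superBracket_odd (a b : R) : superBracket K R true true a b = a * b + b * a := by
  simp [superBracket_apply]

theorem superBracket_even_left (q : Bool) (a b : R) :
    superBracket K R false q a b = a * b - b * a := by
  simp [superBracket_apply]

theorem superBracket_even_right (p : Bool) (a b : R) :
    superBracket K R p false a b = a * b - b * a := by
  simp [superBracket_apply]

theorem superBracket_swap (p q : Bool) (a b : R) :
    superBracket K R p q a b = -(parSign K p q • superBracket K R q p b a) := by
  simp only [superBracket_apply, parSign_comm q p, smul_sub, smul_smul, parSign_mul_self, one_smul]
  abel

/-- The parities are labels and not a grading of `R`, so this is a formal identity in any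
associative algebra. The parity of the inner bracket is a separate variable `s`, so that the rule
rewrites brackets whose labels are literal `true` or `false`. -/
theorem superBracket_jacobi (p q r : Bool) {s : Bool} (h : (p ^^ q) = s) (a b c : R) :
    superBracket K R s r (superBracket K R p q a b) c =
      superBracket K R p (q ^^ r) a (superBracket K R q r b c) -
        parSign K p q • superBracket K R q (p ^^ r) b (superBracket K R p r a c) := by
  subst h
  cases p <;> cases q <;> cases r <;>
    simp [superBracket_odd, superBracket_even_left, superBracket_even_right, mul_add, add_mul,
      mul_sub, sub_mul, mul_assoc] <;> abel

theorem superBracket_mul_left (p q r : Bool) {s : Bool} (h : (p ^^ q) = s) (a b c : R) :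
    superBracket K R s r (a * b) c =
      a * superBracket K R q r b c + parSign K q r • (superBracket K R p r a c * b) := by
  subst h
  cases p <;> cases q <;> cases r <;>
    simp [superBracket_odd, superBracket_even_left, superBracket_even_right, mul_add, add_mul,
      mul_sub, sub_mul, mul_assoc] <;> try abel

theorem superBracket_one_left (q : Bool) (a : R) : superBracket K R false q 1 a = 0 := by
  simp [superBracket_even_left]

theorem superBracket_one_right (q : Bool) (a : R) : superBracket K R q false a 1 = 0 := by
  simp [superBracket_even_right]

end SuperBracket

/-! ### Supercommutation of the symbols and cyclicity of the vacuum. -/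

section Modes

variable {K ℓ : Type*} [Field K] [LieRing ℓ] [LieAlgebra K ℓ]

variable (K ℓ) in
/-- The additive group of operators; as a local instance it makes the module lemmas about negation
apply. -/
@[reducible] def opAddCommGroup : AddCommGroup (Op K ℓ) :=
  inferInstanceAs (AddCommGroup (Module.End K (Space K ℓ)))

attribute [local instance] opAddCommGroup

/-- The action of the Weyl algebra on the vertex operator Weil algebra. -/
def weylAct : Weyl K ℓ →ₐ[K] Op K ℓ :=
  (Module.End.rTensorAlgHom K (SymModule K ℓ) (ExtModule K ℓ)).comp
    (Algebra.lsmul K K (SymModule K ℓ))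

/-- The action of the Clifford algebra on the vertex operator Weil algebra. -/
def cliffAct : Cliff K ℓ →ₐ[K] Op K ℓ :=
  (Module.End.lTensorAlgHom K (ExtModule K ℓ) (SymModule K ℓ)).comp
    (Algebra.lsmul K K (ExtModule K ℓ))

theorem weylOp_eq (v : ModeSpace K ℓ) : weylOp v = weylAct (weylι K ℓ v) := rfl

theorem cliffOp_eq (v : ModeSpace K ℓ) : cliffOp v = cliffAct (cliffι K ℓ v) := rfl

theorem weylAct_tmul (a : Weyl K ℓ) (s : SymModule K ℓ) (e : ExtModule K ℓ) :
    weylAct a (s ⊗ₜ[K] e) = (a • s) ⊗ₜ[K] e := rfl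

theorem cliffAct_tmul (a : Cliff K ℓ) (s : SymModule K ℓ) (e : ExtModule K ℓ) :
    cliffAct a (s ⊗ₜ[K] e) = s ⊗ₜ[K] (a • e) := rfl

theorem weylι_mul (v w : ModeSpace K ℓ) :
    weylι K ℓ v * weylι K ℓ w =
      weylι K ℓ w * weylι K ℓ v + algebraMap K (Weyl K ℓ) (sympForm K ℓ v w) := by
  have h := RingQuot.mkAlgHom_rel K (WeylRel.comm v w)
  rw [map_mul, map_add, map_mul, AlgHom.commutes] at h
  exact h

theorem cliffι_mul (v w : ModeSpace K ℓ) :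
    cliffι K ℓ v * cliffι K ℓ w + cliffι K ℓ w * cliffι K ℓ v =
      algebraMap K (Cliff K ℓ) (halfForm K ℓ v w + halfForm K ℓ w v) := by
  have h := CliffordAlgebra.ι_mul_ι_add_swap (Q := quadForm K ℓ) v w
  rw [quadForm, LinearMap.BilinMap.polar_toQuadraticMap] at h
  exact h

variable (K ℓ) in
/-- The linear map `x ↦ x ⊗ t ^ n`. -/
def loopModeₗ (n : ℤ) : ℓ →ₗ[K] ModeSpace K ℓ :=
  (LinearMap.inl K (ℤ →₀ ℓ) (ℤ →₀ Module.Dual K ℓ)).comp (Finsupp.lsingle n)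

variable (K ℓ) in
/-- The linear map placing a functional in mode number `n`. -/
def dualModeₗ (n : ℤ) : Module.Dual K ℓ →ₗ[K] ModeSpace K ℓ :=
  (LinearMap.inr K (ℤ →₀ ℓ) (ℤ →₀ Module.Dual K ℓ)).comp (Finsupp.lsingle n)

/-- The operators `bₙˣ`, linear in `x`. -/
def bOp (n : ℤ) : ℓ →ₗ[K] Op K ℓ :=
  (cliffAct.toLinearMap ∘ₗ cliffι K ℓ) ∘ₗ loopModeₗ K ℓ n

/-- The operators `cₙᶠ`, linear in `f`. -/
def cOp (n : ℤ) : Module.Dual K ℓ →ₗ[K] Op K ℓ :=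
  (cliffAct.toLinearMap ∘ₗ cliffι K ℓ) ∘ₗ dualModeₗ K ℓ n

/-- The operators `βₙˣ`, linear in `x`. -/
def βOp (n : ℤ) : ℓ →ₗ[K] Op K ℓ :=
  (weylAct.toLinearMap ∘ₗ weylι K ℓ) ∘ₗ loopModeₗ K ℓ n

/-- The operators `γₙᶠ`, linear in `f`. -/
def γOp (n : ℤ) : Module.Dual K ℓ →ₗ[K] Op K ℓ :=
  (weylAct.toLinearMap ∘ₗ weylι K ℓ) ∘ₗ dualModeₗ K ℓ n

theorem op_b (n : ℤ) (x : ℓ) : (Mode.b n x : Mode K ℓ).op = bOp n x := rfl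
theorem op_c (n : ℤ) (f : Module.Dual K ℓ) : (Mode.c n f : Mode K ℓ).op = cOp n f := rfl
theorem op_β (n : ℤ) (x : ℓ) : (Mode.β n x : Mode K ℓ).op = βOp n x := rfl
theorem op_γ (n : ℤ) (f : Module.Dual K ℓ) : (Mode.γ n f : Mode K ℓ).op = γOp n f := rfl

theorem pairing_single (m n : ℤ) (f : Module.Dual K ℓ) (x : ℓ) :
    pairing K ℓ (Finsupp.single n f) (Finsupp.single m x) = if n + m = 0 then f x else 0 := by
  have : pairing K ℓ (Finsupp.single n f) (Finsupp.single m x) =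
      f ((Finsupp.single m x : ℤ →₀ ℓ) (-n)) := by
    simp [pairing]
  rw [this, Finsupp.single_apply]
  split_ifs <;> first | rfl | omega | simp

theorem halfForm_dual_loop (m n : ℤ) (f : Module.Dual K ℓ) (x : ℓ) :
    halfForm K ℓ (dualMode n f) (loopMode m x) = if n + m = 0 then f x else 0 :=
  pairing_single m n f x

theorem halfForm_loop_left (n : ℤ) (x : ℓ) (v : ModeSpace K ℓ) :
    halfForm K ℓ (loopMode n x) v = 0 := by
  change pairing K ℓ 0 v.1 = 0
  simp

theorem halfForm_dual_right (n : ℤ) (f : Module.Dual K ℓ) (v : ModeSpace K ℓ) :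
    halfForm K ℓ v (dualMode n f) = 0 := by
  exact map_zero (pairing K ℓ v.2)

/-- The scalar by which two symbols supercommute. -/
def Mode.contr : Mode K ℓ → Mode K ℓ → K
  | .c n f, .b m x => if n + m = 0 then f x else 0
  | .b n x, .c m f => if n + m = 0 then f x else 0
  | .γ n f, .β m x => if n + m = 0 then f x else 0
  | .β n x, .γ m f => if n + m = 0 then -f x else 0
  | _, _ => 0

theorem weylAct_comm_cliffAct (a : Weyl K ℓ) (b : Cliff K ℓ) :
    weylAct a * cliffAct b = cliffAct b * weylAct a := by
  refine TensorProduct.ext' fun s e => ?_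
  simp [weylAct_tmul, cliffAct_tmul]

theorem superBracket_weylOp (v w : ModeSpace K ℓ) :
    superBracket K (Op K ℓ) false false (weylOp v) (weylOp w) = sympForm K ℓ v w • 1 := by
  rw [superBracket_even_left, weylOp_eq, weylOp_eq, ← map_mul, weylι_mul, map_add, map_mul,
    AlgHom.commutes, Algebra.algebraMap_eq_smul_one, add_sub_cancel_left]

theorem superBracket_cliffOp (v w : ModeSpace K ℓ) :
    superBracket K (Op K ℓ) true true (cliffOp v) (cliffOp w) =
      (halfForm K ℓ v w + halfForm K ℓ w v) • 1 := by
  rw [superBracket_odd, cliffOp_eq, cliffOp_eq, ← map_mul cliffAct, ← map_mul cliffAct,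
    ← map_add, cliffι_mul,
    AlgHom.commutes, Algebra.algebraMap_eq_smul_one]

/-- The Weyl and Clifford relations, and the commutation of the two tensor factors, in one formula.
All later computations use the relations through this form. -/
theorem superBracket_op (m₁ m₂ : Mode K ℓ) :
    superBracket K (Op K ℓ) m₁.isOdd m₂.isOdd m₁.op m₂.op = m₁.contr m₂ • 1 := by
  rcases m₁ with ⟨n, x⟩ | ⟨n, f⟩ | ⟨n, x⟩ | ⟨n, f⟩ <;>
    rcases m₂ with ⟨m, y⟩ | ⟨m, g⟩ | ⟨m, y⟩ | ⟨m, g⟩ <;>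
    simp only [Mode.isOdd, Mode.op, Mode.contr] <;>
    first
    | (rw [superBracket_cliffOp]
       simp [halfForm_dual_loop, halfForm_loop_left, halfForm_dual_right, add_comm])
    | (rw [superBracket_weylOp]
       simp only [sympForm, LinearMap.sub_apply, LinearMap.BilinForm.flip_apply,
         halfForm_dual_loop, halfForm_loop_left, halfForm_dual_right]
       simp [add_comm] <;> (split_ifs <;> simp))
    | (rw [superBracket_even_left, weylOp_eq, cliffOp_eq, weylAct_comm_cliffAct, sub_self,
         zero_smul])
    | (rw [superBracket_even_right, weylOp_eq, cliffOp_eq, weylAct_comm_cliffAct, sub_self,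
         zero_smul])

variable (K ℓ) in
/-- The cyclic vector of the semi-infinite symmetric module. -/
def symVac : SymModule K ℓ := (Submodule.Quotient.mk 1 : Weyl K ℓ ⧸ symIdeal K ℓ)

variable (K ℓ) in
/-- The cyclic vector of the semi-infinite exterior module. -/
def extVac : ExtModule K ℓ := (Submodule.Quotient.mk 1 : Cliff K ℓ ⧸ extIdeal K ℓ)

theorem smul_symVac (a : Weyl K ℓ) :
    a • symVac K ℓ = (Submodule.Quotient.mk a : Weyl K ℓ ⧸ symIdeal K ℓ) := by
  refine (Submodule.Quotient.mk_smul (symIdeal K ℓ) (r := a) (x := 1)).symm.trans ?_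
  rw [smul_eq_mul, mul_one]

theorem smul_extVac (a : Cliff K ℓ) :
    a • extVac K ℓ = (Submodule.Quotient.mk a : Cliff K ℓ ⧸ extIdeal K ℓ) := by
  refine (Submodule.Quotient.mk_smul (extIdeal K ℓ) (r := a) (x := 1)).symm.trans ?_
  rw [smul_eq_mul, mul_one]

variable (K ℓ) in
/-- The vacuum vector. -/
def vac : Space K ℓ := symVac K ℓ ⊗ₜ[K] extVac K ℓ

theorem weylOp_vac {v : ModeSpace K ℓ} (hv : v ∈ annihilationModes K ℓ) :
    weylOp v (vac K ℓ) = 0 := by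
  have h : weylι K ℓ v • symVac K ℓ = 0 := by
    rw [smul_symVac]
    exact (Submodule.Quotient.mk_eq_zero _).2 (Submodule.subset_span ⟨v, hv, rfl⟩)
  rw [weylOp_eq, vac, weylAct_tmul, h, TensorProduct.zero_tmul]

theorem cliffOp_vac {v : ModeSpace K ℓ} (hv : v ∈ annihilationModes K ℓ) :
    cliffOp v (vac K ℓ) = 0 := by
  have h : cliffι K ℓ v • extVac K ℓ = 0 := by
    rw [smul_extVac]
    exact (Submodule.Quotient.mk_eq_zero _).2 (Submodule.subset_span ⟨v, hv, rfl⟩)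
  rw [cliffOp_eq, vac, cliffAct_tmul, h, TensorProduct.tmul_zero]

theorem Mode.op_vac (m : Mode K ℓ) (hm : m.isCreation = false) : m.op (vac K ℓ) = 0 := by
  rcases m with ⟨n, x⟩ | ⟨n, f⟩ | ⟨n, x⟩ | ⟨n, f⟩ <;>
    simp only [Mode.isCreation, decide_eq_false_iff_not, not_le] at hm
  · exact cliffOp_vac (Or.inl ⟨n, x, by omega, rfl⟩)
  · exact cliffOp_vac (Or.inr ⟨n, f, by omega, rfl⟩)
  · exact weylOp_vac (Or.inl ⟨n, x, by omega, rfl⟩)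
  · exact weylOp_vac (Or.inr ⟨n, f, by omega, rfl⟩)

theorem modeSpace_mem {P : Submodule K (ModeSpace K ℓ)} (hl : ∀ n x, loopMode n x ∈ P)
    (hd : ∀ n f, dualMode n f ∈ P) (v : ModeSpace K ℓ) : v ∈ P := by
  obtain ⟨x, f⟩ := v
  have hx : x ∈ P.comap (LinearMap.inl K (ℤ →₀ ℓ) (ℤ →₀ Module.Dual K ℓ)) :=
    Finsupp.induction_linear x (zero_mem _) (fun _ _ => add_mem) fun n y => hl n y
  have hf : f ∈ P.comap (LinearMap.inr K (ℤ →₀ ℓ) (ℤ →₀ Module.Dual K ℓ)) :=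
    Finsupp.induction_linear f (zero_mem _) (fun _ _ => add_mem) fun n y => hd n y
  have h := P.add_mem hx hf
  have e : (LinearMap.inl K (ℤ →₀ ℓ) (ℤ →₀ Module.Dual K ℓ)) x +
      (LinearMap.inr K (ℤ →₀ ℓ) (ℤ →₀ Module.Dual K ℓ)) f = (x, f) := by simp
  rw [← e]
  exact h

/-- The operators preserving a given subspace. -/
def stabilizer {W : Type*} [AddCommGroup W] [Module K W] (P : Submodule K W) :
    Subalgebra K (Module.End K W) where
  carrier := {A | ∀ w ∈ P, A w ∈ P}
  mul_mem' hA hB _ hw := hA _ (hB _ hw)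
  add_mem' hA hB _ hw := add_mem (hA _ hw) (hB _ hw)
  algebraMap_mem' a _ hw := P.smul_mem a hw

theorem weylι_adjoin (S : Subalgebra K (Weyl K ℓ)) (h : ∀ v, weylι K ℓ v ∈ S)
    (a : Weyl K ℓ) : a ∈ S := by
  obtain ⟨a, rfl⟩ := RingQuot.mkAlgHom_surjective K (WeylRel K ℓ) a
  change a ∈ S.comap (weylMk K ℓ)
  induction a using TensorAlgebra.induction with
  | algebraMap r => exact algebraMap_mem _ r
  | ι x => exact h x
  | mul a b ha hb => exact mul_mem ha hb
  | add a b ha hb => exact add_mem ha hb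

theorem cliffι_adjoin (S : Subalgebra K (Cliff K ℓ)) (h : ∀ v, cliffι K ℓ v ∈ S)
    (a : Cliff K ℓ) : a ∈ S := by
  induction a using CliffordAlgebra.induction with
  | algebraMap r => exact algebraMap_mem S r
  | ι x => exact h x
  | mul a b ha hb => exact mul_mem ha hb
  | add a b ha hb => exact add_mem ha hb

/-- The vacuum vector is cyclic. -/
theorem mem_of_stable {P : Submodule K (Space K ℓ)} (h0 : vac K ℓ ∈ P)
    (h : ∀ m : Mode K ℓ, ∀ w ∈ P, m.op w ∈ P) (w : Space K ℓ) : w ∈ P := by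
  have hW (a : Weyl K ℓ) : weylAct a ∈ stabilizer P := by
    refine weylι_adjoin ((stabilizer P).comap weylAct) (fun v => ?_) a
    exact modeSpace_mem (P := (Subalgebra.toSubmodule (stabilizer P)).comap
      (weylAct.toLinearMap ∘ₗ weylι K ℓ)) (fun n x w hw => h (.β n x) w hw)
      (fun n f w hw => h (.γ n f) w hw) v
  have hC (a : Cliff K ℓ) : cliffAct a ∈ stabilizer P := by
    refine cliffι_adjoin ((stabilizer P).comap cliffAct) (fun v => ?_) a
    exact modeSpace_mem (P := (Subalgebra.toSubmodule (stabilizer P)).comap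
      (cliffAct.toLinearMap ∘ₗ cliffι K ℓ)) (fun n x w hw => h (.b n x) w hw)
      (fun n f w hw => h (.c n f) w hw) v
  induction w using TensorProduct.induction_on with
  | zero => exact zero_mem _
  | add x y hx hy => exact add_mem hx hy
  | tmul s e =>
    -- Both factors are cyclic quotients, so each pure tensor is obtained from the vacuum by one
    -- Weyl and one Clifford element.
    obtain ⟨a, rfl⟩ := Submodule.Quotient.mk_surjective (symIdeal K ℓ) s
    obtain ⟨b, rfl⟩ := Submodule.Quotient.mk_surjective (extIdeal K ℓ) e
    have e := hW a _ (hC b _ h0)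
    rw [vac, cliffAct_tmul, weylAct_tmul, smul_symVac, smul_extVac] at e
    exact e

/-- An operator that supercommutes with all symbols and kills the vacuum is zero. -/
theorem eq_zero_of_superBracket {p : Bool} {X : Op K ℓ}
    (h : ∀ m : Mode K ℓ, superBracket K (Op K ℓ) p m.isOdd X m.op = 0)
    (h0 : X (vac K ℓ) = 0) : X = 0 := by
  refine LinearMap.ext fun w => ?_
  refine mem_of_stable (P := LinearMap.ker X) h0 (fun m w hw => ?_) w
  -- The kernel of `X` is stable under each symbol, because `X` can be moved past the symbol up to
  -- sign.
  have e := congrArg (fun A : Op K ℓ => A w) (h m)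
  rw [superBracket_apply] at e
  have hw' : X w = 0 := hw
  simpa [hw'] using e

end Modes

/-! ### Local finiteness and the calculus of infinite sums. -/

section Finiteness

variable {K ℓ : Type*} [Field K] [LieRing ℓ] [LieAlgebra K ℓ]

attribute [local instance] opAddCommGroup

/-- The mode number of a symbol. -/
def Mode.idx : Mode K ℓ → ℤ
  | .b n _ => n
  | .c n _ => n
  | .β n _ => n
  | .γ n _ => n

theorem Mode.isCreation_of_one_le {m : Mode K ℓ} (h : 1 ≤ m.idx) : m.isCreation = false := by
  rcases m with ⟨n, x⟩ | ⟨n, x⟩ | ⟨n, x⟩ | ⟨n, x⟩ <;> simp [Mode.idx, Mode.isCreation] at * <;> omega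

theorem Mode.contr_eq_zero {m₁ m₂ : Mode K ℓ} (h : m₁.idx + m₂.idx ≠ 0) :
    m₁.contr m₂ = 0 := by
  rcases m₁ with ⟨n, x⟩ | ⟨n, x⟩ | ⟨n, x⟩ | ⟨n, x⟩ <;>
    rcases m₂ with ⟨m, y⟩ | ⟨m, y⟩ | ⟨m, y⟩ | ⟨m, y⟩ <;>
    simp only [Mode.idx, Mode.contr] at * <;> simp [h]

theorem Mode.contr_annihilation {m₁ m₂ : Mode K ℓ} (h₁ : m₁.isCreation = false)
    (h₂ : m₂.isCreation = false) : m₁.contr m₂ = 0 := by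
  rcases m₁ with ⟨n, x⟩ | ⟨n, x⟩ | ⟨n, x⟩ | ⟨n, x⟩ <;>
    rcases m₂ with ⟨m, y⟩ | ⟨m, y⟩ | ⟨m, y⟩ | ⟨m, y⟩ <;>
    simp [Mode.contr, Mode.isCreation] at * <;> omega

theorem Mode.op_mul_op (m₁ m₂ : Mode K ℓ) :
    m₁.op * m₂.op =
      parSign K m₁.isOdd m₂.isOdd • (m₂.op * m₁.op) + m₁.contr m₂ • (1 : Op K ℓ) := by
  rw [← superBracket_op, superBracket_apply]
  abel

theorem Mode.op_op (m₁ m₂ : Mode K ℓ) (w : Space K ℓ) :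
    m₁.op (m₂.op w) =
      parSign K m₁.isOdd m₂.isOdd • m₂.op (m₁.op w) + m₁.contr m₂ • w :=
  congrArg (fun A : Op K ℓ => A w) (Mode.op_mul_op m₁ m₂)

/-- The vector `w` is killed by all annihilation operators of mode number at least `N`. -/
def KilledFrom (N : ℤ) (w : Space K ℓ) : Prop :=
  ∀ m : Mode K ℓ, N ≤ m.idx → m.isCreation = false → m.op w = 0

/-- The source of all local finiteness. The vectors with such a bound form a subspace containing the
vacuum, and applying a symbol only raises the bound. -/
theorem exists_killedFrom (w : Space K ℓ) : ∃ N : ℤ, 1 ≤ N ∧ KilledFrom N w := by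
  let P : Submodule K (Space K ℓ) :=
    { carrier := {w | ∃ N : ℤ, 1 ≤ N ∧ KilledFrom N w}
      zero_mem' := ⟨1, le_rfl, fun m _ _ => map_zero _⟩
      add_mem' := by
        rintro v w ⟨N, hN, hv⟩ ⟨M, _, hw⟩
        refine ⟨max N M, hN.trans (le_max_left _ _), fun m hm hc => ?_⟩
        rw [map_add, hv m ((le_max_left _ _).trans hm) hc,
          hw m ((le_max_right _ _).trans hm) hc, add_zero]
      smul_mem' := by
        rintro a w ⟨N, hN, hw⟩
        exact ⟨N, hN, fun m hm hc => by rw [map_smul, hw m hm hc, smul_zero]⟩ }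
  refine mem_of_stable (P := P) ⟨1, le_rfl, fun m _ hc => m.op_vac hc⟩ ?_ w
  rintro m' w ⟨N, hN, hw⟩
  -- From mode number `1 - m'.idx` on, the two mode numbers have positive sum, so no contraction
  -- with `m'` occurs.
  refine ⟨max N (1 - m'.idx), hN.trans (le_max_left _ _), fun m hm hc => ?_⟩
  rw [Mode.op_op, hw m ((le_max_left _ _).trans hm) hc,
    Mode.contr_eq_zero (by have := (le_max_right _ _).trans hm; omega)]
  simp

theorem KilledFrom.op {N : ℤ} {w : Space K ℓ} (hw : KilledFrom N w) {m : Mode K ℓ}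
    (hm : m.isCreation = false) : KilledFrom N (m.op w) := fun m' h' hc => by
  rw [Mode.op_op, hw m' h' hc, Mode.contr_annihilation hc hm]
  simp

/-- Normal ordering leaves only annihilation operators to the right of `m`; these preserve
`KilledFrom N`, since annihilation operators do not contract with each other. -/
theorem normalProd_eq_zero {N : ℤ} {l : List (Mode K ℓ)} {m : Mode K ℓ}
    (hm : m ∈ l) (hN : N ≤ m.idx) (hc : m.isCreation = false) {w : Space K ℓ}
    (hw : KilledFrom N w) : normalProd l w = 0 := by
  induction l generalizing w with
  | nil => simp at hm
  | cons a l ih =>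
    rw [normalProd]
    rcases List.mem_cons.1 hm with rfl | h
    · split_ifs <;> simp_all [hw m hN hc]
    · by_cases ha : a.isCreation = true
      · simp [ha, ih h hw]
      · have e := ih h (hw.op (Bool.eq_false_iff.2 ha))
        split_ifs <;> simp [e]

/-- Serves `h`, `k`, `r`, `t`, which are written without normal ordering: their two factors
supercommute, so either one may be applied first. -/
theorem op_mul_op_eq_zero {N : ℤ} {m₁ m₂ : Mode K ℓ} (h : m₁.contr m₂ = 0)
    {w : Space K ℓ} (hw : KilledFrom N w) (hN : 1 ≤ N) (hi : N ≤ m₁.idx ∨ N ≤ m₂.idx) :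
    (m₁.op * m₂.op) w = 0 := by
  rcases hi with hi | hi
  · rw [Mode.op_mul_op, h, zero_smul, add_zero, LinearMap.smul_apply, Module.End.mul_apply,
      hw m₁ hi (Mode.isCreation_of_one_le (hN.trans hi)), map_zero, smul_zero]
  · rw [Module.End.mul_apply, hw m₂ hi (Mode.isCreation_of_one_le (hN.trans hi)), map_zero]

variable {I : Type*}

theorem locallyFinite_of_subset {f : I → Op K ℓ}
    (h : ∀ N : ℤ, 1 ≤ N → ∃ s : Set I, s.Finite ∧
      ∀ w, KilledFrom N w → ∀ i, i ∉ s → f i w = 0) : LocallyFinite f := fun w => by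
  obtain ⟨N, hN, hw⟩ := exists_killedFrom w
  obtain ⟨s, hs, h⟩ := h N hN
  refine hs.subset fun i hi => ?_
  by_contra his
  exact hi (h w hw i his)

theorem LocallyFinite.add {f g : I → Op K ℓ} (hf : LocallyFinite f) (hg : LocallyFinite g) :
    LocallyFinite fun i => f i + g i := fun w =>
  ((hf w).union (hg w)).subset (Function.support_add _ _)

theorem LocallyFinite.mul_left {f : I → Op K ℓ} (hf : LocallyFinite f) (A : Op K ℓ) :
    LocallyFinite fun i => A * f i := fun w =>
  (hf w).subset fun _ hi h => hi ((congrArg A h).trans (map_zero A))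

theorem LocallyFinite.mul_right {f : I → Op K ℓ} (hf : LocallyFinite f) (A : Op K ℓ) :
    LocallyFinite fun i => f i * A := fun w => hf (A w)

theorem LocallyFinite.smul {f : I → Op K ℓ} (hf : LocallyFinite f) (a : K) :
    LocallyFinite fun i => a • f i := fun w =>
  (hf w).subset fun _ hi h => hi ((congrArg (a • ·) h).trans (smul_zero _))

theorem LocallyFinite.neg {f : I → Op K ℓ} (hf : LocallyFinite f) :
    LocallyFinite fun i => -f i := by
  simpa using hf.smul (-1)

theorem LocallyFinite.superBracket {f : I → Op K ℓ} (hf : LocallyFinite f) (p q : Bool)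
    (A : Op K ℓ) : LocallyFinite fun i => superBracket K (Op K ℓ) p q (f i) A := by
  simp only [superBracket_apply, sub_eq_add_neg]
  exact (hf.mul_right A).add ((hf.mul_left A).smul _).neg

theorem opSum_apply {f : I → Op K ℓ} (hf : LocallyFinite f) (w : Space K ℓ) :
    opSum f w = ∑ᶠ i, f i w := by
  rw [opSum, dif_pos hf]
  rfl

/-- Local finiteness is not required, because the default value of `opSum` is `0`. -/
theorem opSum_apply_eq_zero {f : I → Op K ℓ} {w : Space K ℓ} (h : ∀ i, f i w = 0) :
    opSum f w = 0 := by
  by_cases hf : LocallyFinite f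
  · simp [opSum_apply hf, h]
  · simp [opSum, dif_neg hf]

theorem opSum_add {f g : I → Op K ℓ} (hf : LocallyFinite f) (hg : LocallyFinite g) :
    opSum (fun i => f i + g i) = opSum f + opSum g := by
  refine LinearMap.ext fun w => ?_
  rw [opSum_apply (hf.add hg), LinearMap.add_apply, opSum_apply hf, opSum_apply hg]
  exact finsum_add_distrib (hf w) (hg w)

theorem opSum_mul_left {f : I → Op K ℓ} (hf : LocallyFinite f) (A : Op K ℓ) :
    opSum (fun i => A * f i) = A * opSum f := by
  refine LinearMap.ext fun w => ?_
  rw [opSum_apply (hf.mul_left A), Module.End.mul_apply, opSum_apply hf]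
  exact (AddMonoidHom.map_finsum A.toAddMonoidHom (hf w)).symm

theorem opSum_mul_right {f : I → Op K ℓ} (hf : LocallyFinite f) (A : Op K ℓ) :
    opSum (fun i => f i * A) = opSum f * A := by
  refine LinearMap.ext fun w => ?_
  rw [opSum_apply (hf.mul_right A), Module.End.mul_apply, opSum_apply hf]
  rfl

theorem opSum_smul {f : I → Op K ℓ} (hf : LocallyFinite f) (a : K) :
    opSum (fun i => a • f i) = a • opSum f := by
  have h := opSum_mul_left hf (a • 1)
  simpa using h

theorem superBracket_opSum {f : I → Op K ℓ} (hf : LocallyFinite f) (p q : Bool) (A : Op K ℓ) :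
    superBracket K (Op K ℓ) p q (opSum f) A =
      opSum fun i => superBracket K (Op K ℓ) p q (f i) A := by
  have h := opSum_add (hf.mul_right A) ((hf.mul_left A).smul (-parSign K p q))
  rw [opSum_smul (hf.mul_left A), opSum_mul_left hf, opSum_mul_right hf] at h
  simp only [superBracket_apply]
  simpa [sub_eq_add_neg] using h.symm

theorem opSum_zero {f : I → Op K ℓ} (h : ∀ i, f i = 0) : opSum f = 0 :=
  LinearMap.ext fun w => opSum_apply_eq_zero fun i => by rw [h i]; rfl

/-- A locally finite sum over `I × J` whose terms vanish unless the second index is `j`. -/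
theorem opSum_apply_prod {J : Type*} [Fintype I] {f : I × J → Op K ℓ} (hf : LocallyFinite f)
    (j : J) {w : Space K ℓ} (h : ∀ i k, k ≠ j → f (i, k) w = 0) :
    opSum f w = ∑ i, f (i, j) w := by
  classical
  rw [opSum_apply hf, finsum_eq_sum_of_support_subset (s := Finset.univ ×ˢ {j}),
    Finset.sum_product]
  · simp
  · rintro ⟨i, k⟩ hi
    by_contra hk
    refine hi (h i k fun e => hk ?_)
    simp [e]

theorem opSum_prod {J : Type*} [Fintype I] {f : I × J → Op K ℓ} (hf : LocallyFinite f)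
    (j : J) (h : ∀ i k, k ≠ j → f (i, k) = 0) : opSum f = ∑ i, f (i, j) := by
  refine LinearMap.ext fun w => ?_
  rw [opSum_apply_prod hf j fun i k hk => by rw [h i k hk]; rfl, LinearMap.sum_apply]

theorem opSum_comp_equiv {J : Type*} (e : J ≃ I) {f : I → Op K ℓ} (hf : LocallyFinite f) :
    opSum (fun j => f (e j)) = opSum f := by
  have hf' : LocallyFinite fun j => f (e j) := fun w => by
    exact (hf w).preimage e.injective.injOn
  refine LinearMap.ext fun w => ?_
  rw [opSum_apply hf, opSum_apply hf']
  exact finsum_comp_equiv e (f := fun i => f i w)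

/-- A locally finite sum over `I × J × A`, with terms vanishing unless the middle index is `j`. -/
theorem opSum_fiber {J A : Type*} [Fintype I] {f : (I × J) × A → Op K ℓ} (hf : LocallyFinite f)
    (j : J) (h : ∀ i k a, k ≠ j → f ((i, k), a) = 0) :
    opSum f = opSum fun a => ∑ i, f ((i, j), a) := by
  have hg : LocallyFinite fun a => ∑ i, f ((i, j), a) := fun w => by
    refine ((hf w).image Prod.snd).subset fun a ha => ?_
    obtain ⟨i, -, hi⟩ := Finset.exists_ne_zero_of_sum_ne_zero
      (by simpa [LinearMap.sum_apply] using ha : ∑ i, f ((i, j), a) w ≠ 0)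
    exact ⟨((i, j), a), hi, rfl⟩
  refine LinearMap.ext fun w => ?_
  rw [opSum_apply hf, opSum_apply hg,
    ← finsum_comp_equiv (Equiv.prodComm A (I × J)), finsum_curry]
  · refine finsum_congr fun a => ?_
    classical
    rw [finsum_eq_sum_of_support_subset (s := Finset.univ ×ˢ {j}), Finset.sum_product]
    · simp [LinearMap.sum_apply]
    · rintro ⟨i, k⟩ hi
      by_contra hk
      refine hi ?_
      simp [h i k a fun e => hk (by simp [e])]
  · exact (hf w).preimage (Equiv.prodComm A (I × J)).injective.injOn

end Finiteness

/-! ### Brackets of the quadratic operators with the symbols. -/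

section Quadratic

set_option linter.unusedSectionVars false

variable {K ℓ : Type*} [Field K] [LieRing ℓ] [LieAlgebra K ℓ]

attribute [local instance] opAddCommGroup

theorem killedFrom_vac (N : ℤ) : KilledFrom N (vac K ℓ) := fun m _ hc => m.op_vac hc

theorem normalProd_vac {l : List (Mode K ℓ)} {m : Mode K ℓ} (hm : m ∈ l)
    (hc : m.isCreation = false) : normalProd l (vac K ℓ) = 0 :=
  normalProd_eq_zero hm le_rfl hc (killedFrom_vac m.idx)

theorem op_mul_op_vac {m₁ m₂ : Mode K ℓ} (h : m₁.contr m₂ = 0)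
    (hc : m₁.isCreation = false ∨ m₂.isCreation = false) : (m₁.op * m₂.op) (vac K ℓ) = 0 := by
  rcases hc with hc | hc
  · rw [Mode.op_mul_op, h, zero_smul, add_zero, LinearMap.smul_apply, Module.End.mul_apply,
      m₁.op_vac hc, map_zero, smul_zero]
  · rw [Module.End.mul_apply, m₂.op_vac hc, map_zero]

theorem normalProd_singleton (m : Mode K ℓ) : normalProd [m] = m.op := by
  simp [normalProd]

/-- Normal ordering alters a quadratic product by a scalar only, which is invisible to brackets; it
matters for convergence and for the value on the vacuum. -/
theorem normalProd_pair (m₁ m₂ : Mode K ℓ) :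
    ∃ s : K, normalProd [m₁, m₂] = m₁.op * m₂.op + s • (1 : Op K ℓ) := by
  by_cases h : m₁.isCreation = true
  · exact ⟨0, by rw [normalProd, if_pos h, normalProd_singleton, zero_smul, add_zero]⟩
  · refine ⟨-m₁.contr m₂, ?_⟩
    have e : (if m₁.isOdd = true then (-1 : K) ^ [m₂].countP Mode.isOdd else 1) =
        parSign K m₁.isOdd m₂.isOdd := by
      cases h₁ : m₁.isOdd <;> cases h₂ : m₂.isOdd <;> simp [h₂]
    rw [normalProd, if_neg h, normalProd_singleton, e, Mode.op_mul_op m₁ m₂]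
    module

theorem superBracket_mul_op (m₁ m₂ g : Mode K ℓ) {p : Bool} (hp : (m₁.isOdd ^^ m₂.isOdd) = p) :
    superBracket K (Op K ℓ) p g.isOdd (m₁.op * m₂.op) g.op =
      m₂.contr g • m₁.op + (parSign K m₂.isOdd g.isOdd * m₁.contr g) • m₂.op := by
  rw [superBracket_mul_left _ _ _ hp, superBracket_op, superBracket_op, mul_smul, mul_smul_comm,
    smul_mul_assoc, mul_one, one_mul]

theorem superBracket_normalProd_pair (m₁ m₂ g : Mode K ℓ) (hp : (m₁.isOdd ^^ m₂.isOdd) = false) :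
    superBracket K (Op K ℓ) false g.isOdd (normalProd [m₁, m₂]) g.op =
      m₂.contr g • m₁.op + (parSign K m₂.isOdd g.isOdd * m₁.contr g) • m₂.op := by
  obtain ⟨s, hs⟩ := normalProd_pair m₁ m₂
  rw [hs, map_add, LinearMap.add_apply, superBracket_mul_op _ _ _ hp, map_smul,
    LinearMap.smul_apply, superBracket_one_left, smul_zero, add_zero]

variable {ι : Type*} [Fintype ι] (B : Module.Basis ι K ℓ)

/-- This and its dual version below remove the basis: after a contraction, the sum over `u` is the
expansion of a vector or functional. -/
theorem sum_coord_smul {V : Type*} [AddCommGroup V] [Module K V] (F : ℓ →ₗ[K] V) (x : ℓ) :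
    ∑ u, B.coord u x • F (B u) = F x := by
  conv_rhs => rw [← B.sum_repr x, map_sum]
  simp

theorem sum_dual_smul {V : Type*} [AddCommGroup V] [Module K V] (F : Module.Dual K ℓ →ₗ[K] V)
    (f : Module.Dual K ℓ) : ∑ u, f (B u) • F (B.coord u) = F f := by
  have h : f = ∑ u, f (B u) • B.coord u := B.ext fun v => by
    classical
    simp
  conv_rhs => rw [h, map_sum]
  simp

/-- The factor `δ_{m+n,0}` in a contraction leaves one mode `j`, which turns the infinite sum into a
finite sum over the basis. -/
theorem superBracket_opSum_single {f : ι × ℤ → Op K ℓ} (hf : LocallyFinite f) (p q : Bool)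
    (A : Op K ℓ) (j : ℤ) (g : ι → Op K ℓ)
    (h : ∀ u m, superBracket K (Op K ℓ) p q (f (u, m)) A = if m = j then g u else 0) :
    superBracket K (Op K ℓ) p q (opSum f) A = ∑ u, g u := by
  rw [superBracket_opSum hf, opSum_prod (hf.superBracket p q A) j]
  · exact Finset.sum_congr rfl fun u _ => by rw [h, if_pos rfl]
  · intro u m hm
    rw [h, if_neg hm]

theorem superBracket_opSum_eq_zero {I : Type*} {f : I → Op K ℓ} (hf : LocallyFinite f)
    (p q : Bool) (A : Op K ℓ) (h : ∀ i, superBracket K (Op K ℓ) p q (f i) A = 0) :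
    superBracket K (Op K ℓ) p q (opSum f) A = 0 := by
  rw [superBracket_opSum hf, opSum_zero h]

theorem locallyFinite_of_window {f : ι × ℤ → Op K ℓ}
    (h : ∀ N : ℤ, 1 ≤ N → ∃ M : ℤ, ∀ w, KilledFrom N w → ∀ u m, m < -M ∨ M < m → f (u, m) w = 0) :
    LocallyFinite f := by
  refine locallyFinite_of_subset fun N hN => ?_
  obtain ⟨M, hM⟩ := h N hN
  refine ⟨Set.univ ×ˢ Set.Icc (-M) M, Set.finite_univ.prod (Set.finite_Icc _ _), ?_⟩
  rintro w hw ⟨u, m⟩ hm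
  refine hM w hw u m ?_
  by_contra! h'
  exact hm ⟨trivial, h'⟩

/-- The terms `p(m) (:β_{n+m}^{D u} γ_{-m}^{u'}: + :b_{n+m}^{D u} c_{-m}^{u'}:)`. -/
def gradTerm (p : ℤ → K) (D : ℓ →ₗ[K] ℓ) (n : ℤ) (q : ι × ℤ) : Op K ℓ :=
  p q.2 • (normalProd [.β (n + q.2) (D (B q.1)), .γ (-q.2) (B.coord q.1)] +
    normalProd [.b (n + q.2) (D (B q.1)), .c (-q.2) (B.coord q.1)])

/-- The operator `∑ p(m) (:β_{n+m}^{D u} γ_{-m}^{u'}: + :b_{n+m}^{D u} c_{-m}^{u'}:)`. -/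
def gradOp (p : ℤ → K) (D : ℓ →ₗ[K] ℓ) (n : ℤ) : Op K ℓ := opSum (gradTerm B p D n)

theorem gradTerm_apply_eq_zero {N : ℤ} {w : Space K ℓ} (hw : KilledFrom N w) (hN : 1 ≤ N)
    (p : ℤ → K) (D : ℓ →ₗ[K] ℓ) (n : ℤ) (u : ι) (m : ℤ) (hm : N ≤ n + m ∨ N ≤ -m) :
    gradTerm B p D n (u, m) w = 0 := by
  rw [gradTerm, LinearMap.smul_apply, LinearMap.add_apply]
  rcases hm with hm | hm
  · rw [normalProd_eq_zero (m := .β (n + m) (D (B u))) (by simp) hm _ hw,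
      normalProd_eq_zero (m := .b (n + m) (D (B u))) (by simp) hm _ hw, add_zero, smul_zero]
    all_goals exact Mode.isCreation_of_one_le (hN.trans hm)
  · rw [normalProd_eq_zero (m := .γ (-m) (B.coord u)) (by simp) hm _ hw,
      normalProd_eq_zero (m := .c (-m) (B.coord u)) (by simp) hm _ hw, add_zero, smul_zero]
    all_goals exact Mode.isCreation_of_one_le (hN.trans hm)

theorem locallyFinite_gradTerm (p : ℤ → K) (D : ℓ →ₗ[K] ℓ) (n : ℤ) :
    LocallyFinite (gradTerm B p D n) :=
  locallyFinite_of_window fun N hN => ⟨N + |n|, fun w hw u m hm =>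
    gradTerm_apply_eq_zero B hw hN p D n u m (by
      have := abs_le.1 (le_refl |n|)
      omega)⟩

/-- In each term one factor annihilates: the dual one if `m < 0`, the other one if `m ≥ 0`. For
negative `n` in place of `0` a term can consist of two creation operators. -/
theorem gradOp_vac (p : ℤ → K) (D : ℓ →ₗ[K] ℓ) : gradOp B p D 0 (vac K ℓ) = 0 := by
  refine opSum_apply_eq_zero fun ⟨u, m⟩ => ?_
  rw [gradTerm, LinearMap.smul_apply, LinearMap.add_apply]
  rcases lt_or_ge m 0 with hm | hm
  · rw [normalProd_vac (m := .γ (-m) (B.coord u)) (by simp),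
      normalProd_vac (m := .c (-m) (B.coord u)) (by simp), add_zero, smul_zero]
    all_goals simp [Mode.isCreation]; omega
  · rw [normalProd_vac (m := .β (0 + m) (D (B u))) (by simp),
      normalProd_vac (m := .b (0 + m) (D (B u))) (by simp), add_zero, smul_zero]
    all_goals simp [Mode.isCreation]; omega

theorem superBracket_gradTerm (p : ℤ → K) (D : ℓ →ₗ[K] ℓ) (n : ℤ) (u : ι) (m : ℤ)
    (g : Mode K ℓ) :
    superBracket K (Op K ℓ) false g.isOdd (gradTerm B p D n (u, m)) g.op =
      p m • ((Mode.γ (-m) (B.coord u)).contr g • βOp (n + m) (D (B u)) +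
        (Mode.β (n + m) (D (B u))).contr g • γOp (-m) (B.coord u) +
        ((Mode.c (-m) (B.coord u)).contr g • bOp (n + m) (D (B u)) +
        (parSign K true g.isOdd * (Mode.b (n + m) (D (B u))).contr g) •
          cOp (-m) (B.coord u))) := by
  rw [gradTerm, map_smul, LinearMap.smul_apply, map_add, LinearMap.add_apply,
    superBracket_normalProd_pair _ _ _ rfl, superBracket_normalProd_pair _ _ _ rfl]
  simp [op_b, op_c, op_β, op_γ, Mode.isOdd]

theorem gradOp_β (p : ℤ → K) (D : ℓ →ₗ[K] ℓ) (n k : ℤ) (x : ℓ) :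
    superBracket K (Op K ℓ) false false (gradOp B p D n) (βOp k x) =
      p k • βOp (n + k) (D x) := by
  rw [gradOp, superBracket_opSum_single (locallyFinite_gradTerm B p D n) _ _ _ k
    fun u => p k • B.coord u x • (βOp (n + k) ∘ₗ D) (B u), ← Finset.smul_sum, sum_coord_smul]
  · rfl
  · intro u m
    refine (superBracket_gradTerm B p D n u m (.β k x)).trans ?_
    simp only [Mode.contr, neg_add_eq_zero]
    split_ifs with h <;> simp [h]

theorem gradOp_b (p : ℤ → K) (D : ℓ →ₗ[K] ℓ) (n k : ℤ) (x : ℓ) :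
    superBracket K (Op K ℓ) false true (gradOp B p D n) (bOp k x) =
      p k • bOp (n + k) (D x) := by
  rw [gradOp, superBracket_opSum_single (locallyFinite_gradTerm B p D n) _ _ _ k
    fun u => p k • B.coord u x • (bOp (n + k) ∘ₗ D) (B u), ← Finset.smul_sum, sum_coord_smul]
  · rfl
  · intro u m
    refine (superBracket_gradTerm B p D n u m (.b k x)).trans ?_
    simp only [Mode.contr, neg_add_eq_zero]
    split_ifs with h <;> simp [h]

theorem gradOp_γ (p : ℤ → K) (D : ℓ →ₗ[K] ℓ) (n k : ℤ) (f : Module.Dual K ℓ) :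
    superBracket K (Op K ℓ) false false (gradOp B p D n) (γOp k f) =
      -p (-n - k) • γOp (n + k) (f ∘ₗ D) := by
  rw [gradOp, superBracket_opSum_single (locallyFinite_gradTerm B p D n) _ _ _ (-n - k)
    fun u => -p (-n - k) • (f ∘ₗ D) (B u) • γOp (n + k) (B.coord u), ← Finset.smul_sum,
    sum_dual_smul]
  intro u m
  refine (superBracket_gradTerm B p D n u m (.γ k f)).trans ?_
  have e : n + m + k = 0 ↔ m = -n - k := by omega
  simp only [Mode.contr, e]
  split_ifs with h
  · simp [h, show k + n = n + k by ring]
  · simp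

theorem gradOp_c (p : ℤ → K) (D : ℓ →ₗ[K] ℓ) (n k : ℤ) (f : Module.Dual K ℓ) :
    superBracket K (Op K ℓ) false true (gradOp B p D n) (cOp k f) =
      -p (-n - k) • cOp (n + k) (f ∘ₗ D) := by
  rw [gradOp, superBracket_opSum_single (locallyFinite_gradTerm B p D n) _ _ _ (-n - k)
    fun u => -p (-n - k) • (f ∘ₗ D) (B u) • cOp (n + k) (B.coord u), ← Finset.smul_sum,
    sum_dual_smul]
  intro u m
  refine (superBracket_gradTerm B p D n u m (.c k f)).trans ?_
  have e : n + m + k = 0 ↔ m = -n - k := by omega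
  simp only [Mode.contr, e]
  split_ifs with h
  · simp [h, Mode.isOdd, show k + n = n + k by ring]
  · simp

/-- `L_n` and `θ(x_n)` are the instances `p m = -m`, `D = id` and `p = 1`, `D = ad x` of `gradOp`,
so their brackets with symbols are computed once. -/
theorem virTerm_eq (n : ℤ) :
    virTerm B n = gradTerm B (fun m => -(m : K)) LinearMap.id n := by
  funext ⟨u, m⟩
  simp only [virTerm, gradTerm, LinearMap.id_apply]
  module

theorem thetaTerm_eq (x : ℓ) (n : ℤ) :
    thetaTerm B x n = gradTerm B (fun _ => 1) (LieAlgebra.ad K ℓ x : ℓ →ₗ[K] ℓ) n := by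
  funext ⟨u, m⟩
  simp only [thetaTerm, gradTerm, LieAlgebra.ad_apply, one_smul]

theorem virOp_eq (n : ℤ) : virOp B n = gradOp B (fun m => -(m : K)) LinearMap.id n := by
  rw [virOp, virTerm_eq, gradOp]

theorem thetaOp_eq (x : ℓ) (n : ℤ) :
    thetaOp B x n = gradOp B (fun _ => 1) (LieAlgebra.ad K ℓ x : ℓ →ₗ[K] ℓ) n := by
  rw [thetaOp, thetaTerm_eq, gradOp]

variable (φ : ℓ ≃ₗ[K] Module.Dual K ℓ)

theorem locallyFinite_rTerm : LocallyFinite (rTerm B φ) :=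
  locallyFinite_of_window fun N hN => ⟨N, fun w hw u m hm => by
    rw [rTerm, LinearMap.smul_apply, op_mul_op_eq_zero rfl hw hN (by simp [Mode.idx]; omega),
      smul_zero]⟩

theorem locallyFinite_tTerm : LocallyFinite (tTerm B φ) :=
  locallyFinite_of_window fun N hN => ⟨N, fun w hw u m hm => by
    rw [tTerm, op_mul_op_eq_zero rfl hw hN (by simp [Mode.idx]; omega)]⟩

theorem locallyFinite_koszulTerm : LocallyFinite (koszulTerm B) :=
  locallyFinite_of_window fun N hN => ⟨N, fun w hw u m hm => by
    rw [koszulTerm, op_mul_op_eq_zero rfl hw hN (by simp [Mode.idx]; omega)]⟩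

theorem locallyFinite_homotopyTerm : LocallyFinite (homotopyTerm B) :=
  locallyFinite_of_window fun N hN => ⟨N, fun w hw u m hm => by
    rw [homotopyTerm, LinearMap.smul_apply,
      op_mul_op_eq_zero rfl hw hN (by simp [Mode.idx]; omega), smul_zero]⟩

theorem rOp_vac : rOp B φ (vac K ℓ) = 0 := opSum_apply_eq_zero fun ⟨u, m⟩ => by
  rcases eq_or_ne m 0 with rfl | hm
  -- In mode `0` both `γ_0` and `c_0` are creation operators, but the coefficient is `0`.
  · simp [rTerm]
  · rw [rTerm, LinearMap.smul_apply, op_mul_op_vac rfl, smul_zero]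
    simp [Mode.isCreation]; omega

theorem tOp_vac : tOp B φ (vac K ℓ) = 0 := opSum_apply_eq_zero fun ⟨u, m⟩ => by
  rw [tTerm, op_mul_op_vac rfl]
  simp [Mode.isCreation]; omega

theorem koszulOp_vac : koszulOp B (vac K ℓ) = 0 := opSum_apply_eq_zero fun ⟨u, m⟩ => by
  rw [koszulTerm, op_mul_op_vac rfl]
  simp [Mode.isCreation]; omega

theorem homotopyOp_vac : homotopyOp B (vac K ℓ) = 0 := opSum_apply_eq_zero fun ⟨u, m⟩ => by
  rw [homotopyTerm, LinearMap.smul_apply, op_mul_op_vac rfl, smul_zero]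
  simp [Mode.isCreation]; omega

theorem superBracket_rTerm (u : ι) (m : ℤ) (g : Mode K ℓ) :
    superBracket K (Op K ℓ) true g.isOdd (rTerm B φ (u, m)) g.op =
      (m : K) • ((Mode.c m (B.coord u)).contr g • γOp (-m) (φ (B u)) +
        (parSign K true g.isOdd * (Mode.γ (-m) (φ (B u))).contr g) • cOp m (B.coord u)) := by
  rw [rTerm, map_smul, LinearMap.smul_apply, superBracket_mul_op (p := true) _ _ _ rfl]
  rfl

theorem superBracket_tTerm (u : ι) (m : ℤ) (g : Mode K ℓ) :
    superBracket K (Op K ℓ) true g.isOdd (tTerm B φ (u, m)) g.op =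
      (Mode.b m (B u)).contr g • βOp (-m) (φ.symm (B.coord u)) +
        (parSign K true g.isOdd * (Mode.β (-m) (φ.symm (B.coord u))).contr g) • bOp m (B u) := by
  rw [tTerm, superBracket_mul_op (p := true) _ _ _ rfl]
  rfl

theorem superBracket_koszulTerm (u : ι) (m : ℤ) (g : Mode K ℓ) :
    superBracket K (Op K ℓ) true g.isOdd (koszulTerm B (u, m)) g.op =
      (Mode.b m (B u)).contr g • γOp (-m) (B.coord u) +
        (parSign K true g.isOdd * (Mode.γ (-m) (B.coord u)).contr g) • bOp m (B u) := by
  rw [koszulTerm, superBracket_mul_op (p := true) _ _ _ rfl]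
  rfl

theorem superBracket_homotopyTerm (u : ι) (m : ℤ) (g : Mode K ℓ) :
    superBracket K (Op K ℓ) true g.isOdd (homotopyTerm B (u, m)) g.op =
      (m : K) • ((Mode.c (-m) (B.coord u)).contr g • βOp m (B u) +
        (parSign K true g.isOdd * (Mode.β m (B u)).contr g) • cOp (-m) (B.coord u)) := by
  rw [homotopyTerm, map_smul, LinearMap.smul_apply, superBracket_mul_op (p := true) _ _ _ rfl]
  rfl

theorem rOp_b (k : ℤ) (x : ℓ) :
    superBracket K (Op K ℓ) true true (rOp B φ) (bOp k x) = (-k : K) • γOp k (φ x) := by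
  rw [rOp, superBracket_opSum_single (locallyFinite_rTerm B φ) _ _ _ (-k)
    fun u => (-k : K) • B.coord u x • (γOp k ∘ₗ φ.toLinearMap) (B u), ← Finset.smul_sum,
    sum_coord_smul]
  · rfl
  · intro u m
    refine (superBracket_rTerm B φ u m (.b k x)).trans ?_
    simp only [Mode.contr, add_eq_zero_iff_eq_neg]
    split_ifs with h <;> simp [h]

theorem rOp_c (k : ℤ) (f : Module.Dual K ℓ) :
    superBracket K (Op K ℓ) true true (rOp B φ) (cOp k f) = 0 :=
  superBracket_opSum_eq_zero (locallyFinite_rTerm B φ) _ _ _ fun ⟨u, m⟩ =>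
    (superBracket_rTerm B φ u m (.c k f)).trans (by simp [Mode.contr])

/-- The contraction gives `φ u x`; symmetry makes it `φ x u`, the coefficient of `u'` in the
functional `φ x`. -/
theorem rOp_β (hφ : ∀ x y, φ x y = φ y x) (k : ℤ) (x : ℓ) :
    superBracket K (Op K ℓ) true false (rOp B φ) (βOp k x) = (k : K) • cOp k (φ x) := by
  rw [rOp, superBracket_opSum_single (locallyFinite_rTerm B φ) _ _ _ k
    fun u => (k : K) • φ x (B u) • cOp k (B.coord u), ← Finset.smul_sum, sum_dual_smul]
  intro u m
  refine (superBracket_rTerm B φ u m (.β k x)).trans ?_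
  simp only [Mode.contr, neg_add_eq_zero]
  split_ifs with h <;> simp [h, hφ x, Mode.isOdd]

theorem rOp_γ (k : ℤ) (f : Module.Dual K ℓ) :
    superBracket K (Op K ℓ) true false (rOp B φ) (γOp k f) = 0 :=
  superBracket_opSum_eq_zero (locallyFinite_rTerm B φ) _ _ _ fun ⟨u, m⟩ =>
    (superBracket_rTerm B φ u m (.γ k f)).trans (by simp [Mode.contr])

theorem tOp_b (k : ℤ) (x : ℓ) :
    superBracket K (Op K ℓ) true true (tOp B φ) (bOp k x) = 0 :=
  superBracket_opSum_eq_zero (locallyFinite_tTerm B φ) _ _ _ fun ⟨u, m⟩ =>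
    (superBracket_tTerm B φ u m (.b k x)).trans (by simp [Mode.contr])

theorem tOp_c (k : ℤ) (f : Module.Dual K ℓ) :
    superBracket K (Op K ℓ) true true (tOp B φ) (cOp k f) = βOp k (φ.symm f) := by
  rw [tOp, superBracket_opSum_single (locallyFinite_tTerm B φ) _ _ _ (-k)
    fun u => f (B u) • (βOp k ∘ₗ φ.symm.toLinearMap) (B.coord u), sum_dual_smul]
  · rfl
  · intro u m
    refine (superBracket_tTerm B φ u m (.c k f)).trans ?_
    simp only [Mode.contr, add_eq_zero_iff_eq_neg]
    split_ifs with h <;> simp [h]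

theorem tOp_β (k : ℤ) (x : ℓ) :
    superBracket K (Op K ℓ) true false (tOp B φ) (βOp k x) = 0 :=
  superBracket_opSum_eq_zero (locallyFinite_tTerm B φ) _ _ _ fun ⟨u, m⟩ =>
    (superBracket_tTerm B φ u m (.β k x)).trans (by simp [Mode.contr])

theorem tOp_γ (hφ : ∀ x y, φ x y = φ y x) (k : ℤ) (f : Module.Dual K ℓ) :
    superBracket K (Op K ℓ) true false (tOp B φ) (γOp k f) = (-1 : K) • bOp k (φ.symm f) := by
  rw [tOp, superBracket_opSum_single (locallyFinite_tTerm B φ) _ _ _ k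
    fun u => (-1 : K) • B.coord u (φ.symm f) • bOp k (B u), ← Finset.smul_sum, sum_coord_smul]
  intro u m
  -- Symmetry of the inverse form on the dual space.
  have e : f (φ.symm (B.coord u)) = B.coord u (φ.symm f) := by
    have := hφ (φ.symm f) (φ.symm (B.coord u))
    rwa [φ.apply_symm_apply, φ.apply_symm_apply] at this
  refine (superBracket_tTerm B φ u m (.γ k f)).trans ?_
  simp only [Mode.contr, neg_add_eq_zero, e]
  split_ifs with h <;> simp [h, Mode.isOdd]

theorem koszulOp_b (k : ℤ) (x : ℓ) :
    superBracket K (Op K ℓ) true true (koszulOp B) (bOp k x) = 0 :=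
  superBracket_opSum_eq_zero (locallyFinite_koszulTerm B) _ _ _ fun ⟨u, m⟩ =>
    (superBracket_koszulTerm B u m (.b k x)).trans (by simp [Mode.contr])

theorem koszulOp_c (k : ℤ) (f : Module.Dual K ℓ) :
    superBracket K (Op K ℓ) true true (koszulOp B) (cOp k f) = γOp k f := by
  rw [koszulOp, superBracket_opSum_single (locallyFinite_koszulTerm B) _ _ _ (-k)
    fun u => f (B u) • γOp k (B.coord u), sum_dual_smul]
  intro u m
  refine (superBracket_koszulTerm B u m (.c k f)).trans ?_
  simp only [Mode.contr, add_eq_zero_iff_eq_neg]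
  split_ifs with h <;> simp [h]

theorem koszulOp_β (k : ℤ) (x : ℓ) :
    superBracket K (Op K ℓ) true false (koszulOp B) (βOp k x) = bOp k x := by
  rw [koszulOp, superBracket_opSum_single (locallyFinite_koszulTerm B) _ _ _ k
    fun u => B.coord u x • bOp k (B u), sum_coord_smul]
  intro u m
  refine (superBracket_koszulTerm B u m (.β k x)).trans ?_
  simp only [Mode.contr, neg_add_eq_zero]
  split_ifs with h <;> simp [h, Mode.isOdd]

theorem koszulOp_γ (k : ℤ) (f : Module.Dual K ℓ) :
    superBracket K (Op K ℓ) true false (koszulOp B) (γOp k f) = 0 :=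
  superBracket_opSum_eq_zero (locallyFinite_koszulTerm B) _ _ _ fun ⟨u, m⟩ =>
    (superBracket_koszulTerm B u m (.γ k f)).trans (by simp [Mode.contr])

theorem homotopyOp_b (k : ℤ) (x : ℓ) :
    superBracket K (Op K ℓ) true true (homotopyOp B) (bOp k x) = (k : K) • βOp k x := by
  rw [homotopyOp, superBracket_opSum_single (locallyFinite_homotopyTerm B) _ _ _ k
    fun u => (k : K) • B.coord u x • βOp k (B u), ← Finset.smul_sum, sum_coord_smul]
  intro u m
  refine (superBracket_homotopyTerm B u m (.b k x)).trans ?_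
  simp only [Mode.contr, neg_add_eq_zero]
  split_ifs with h <;> simp [h]

theorem homotopyOp_c (k : ℤ) (f : Module.Dual K ℓ) :
    superBracket K (Op K ℓ) true true (homotopyOp B) (cOp k f) = 0 :=
  superBracket_opSum_eq_zero (locallyFinite_homotopyTerm B) _ _ _ fun ⟨u, m⟩ =>
    (superBracket_homotopyTerm B u m (.c k f)).trans (by simp [Mode.contr])

theorem homotopyOp_β (k : ℤ) (x : ℓ) :
    superBracket K (Op K ℓ) true false (homotopyOp B) (βOp k x) = 0 :=
  superBracket_opSum_eq_zero (locallyFinite_homotopyTerm B) _ _ _ fun ⟨u, m⟩ =>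
    (superBracket_homotopyTerm B u m (.β k x)).trans (by simp [Mode.contr])

theorem homotopyOp_γ (k : ℤ) (f : Module.Dual K ℓ) :
    superBracket K (Op K ℓ) true false (homotopyOp B) (γOp k f) = (k : K) • cOp k f := by
  rw [homotopyOp, superBracket_opSum_single (locallyFinite_homotopyTerm B) _ _ _ (-k)
    fun u => (k : K) • f (B u) • cOp k (B.coord u), ← Finset.smul_sum, sum_dual_smul]
  intro u m
  refine (superBracket_homotopyTerm B u m (.γ k f)).trans ?_
  simp only [Mode.contr, add_eq_zero_iff_eq_neg]
  split_ifs with h <;> simp [h, Mode.isOdd]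

end Quadratic

/-! ### Brackets of the cubic operator `Q` with the symbols. -/

section Differential

set_option linter.unusedSectionVars false

variable {K ℓ : Type*} [Field K] [LieRing ℓ] [LieAlgebra K ℓ]

attribute [local instance] opAddCommGroup

theorem normalProd_pair_annihilation {m₁ : Mode K ℓ} (h : ¬m₁.isCreation = true)
    (m₂ : Mode K ℓ) :
    normalProd [m₁, m₂] = parSign K m₁.isOdd m₂.isOdd • (m₂.op * m₁.op) := by
  have e : (if m₁.isOdd = true then (-1 : K) ^ [m₂].countP Mode.isOdd else 1) =
      parSign K m₁.isOdd m₂.isOdd := by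
    cases h₁ : m₁.isOdd <;> cases h₂ : m₂.isOdd <;> simp [h₂]
  rw [normalProd, if_neg h, normalProd_singleton, e]

theorem normalProd_triple_annihilation {m₁ : Mode K ℓ} (h : ¬m₁.isCreation = true)
    (m₂ m₃ : Mode K ℓ) :
    normalProd [m₁, m₂, m₃] = (parSign K m₁.isOdd m₂.isOdd * parSign K m₁.isOdd m₃.isOdd) •
      (normalProd [m₂, m₃] * m₁.op) := by
  have e : (if m₁.isOdd = true then (-1 : K) ^ [m₂, m₃].countP Mode.isOdd else 1) =
      parSign K m₁.isOdd m₂.isOdd * parSign K m₁.isOdd m₃.isOdd := by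
    cases h₁ : m₁.isOdd <;> cases h₂ : m₂.isOdd <;> cases h₃ : m₃.isOdd <;> simp [h₂, h₃]
  rw [normalProd, if_neg h, e]

theorem normalProd_pair_of_contr {m₁ m₂ : Mode K ℓ} (h : m₁.contr m₂ = 0) :
    normalProd [m₁, m₂] = m₁.op * m₂.op := by
  by_cases hc : m₁.isCreation = true
  · rw [normalProd, if_pos hc, normalProd_singleton]
  · rw [normalProd_pair_annihilation hc, Mode.op_mul_op m₁ m₂, h, zero_smul, add_zero]

/-- Only symbols of equal parity contract, and then the two signs agree. -/
theorem parSign_mul_contr (p : Bool) (a b : Mode K ℓ) :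
    parSign K p a.isOdd * parSign K p b.isOdd * a.contr b = a.contr b := by
  rcases a with ⟨n, x⟩ | ⟨n, x⟩ | ⟨n, x⟩ | ⟨n, x⟩ <;>
    rcases b with ⟨m, y⟩ | ⟨m, y⟩ | ⟨m, y⟩ | ⟨m, y⟩ <;>
    simp only [Mode.contr, Mode.isOdd, parSign_mul_self, one_mul, mul_zero]

/-- Normal ordering corrects a cubic product by linear terms. In `Q` these are multiples of `c`'s,
which are invisible in brackets with symbols other than `b`. -/
theorem normalProd_triple {m₁ m₂ m₃ : Mode K ℓ} (h : m₂.contr m₃ = 0) :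
    ∃ k : K, normalProd [m₁, m₂, m₃] = m₁.op * (m₂.op * m₃.op) +
      ((k * m₁.contr m₂) • m₃.op + (k * (parSign K m₁.isOdd m₂.isOdd * m₁.contr m₃)) • m₂.op) := by
  by_cases hc : m₁.isCreation = true
  · exact ⟨0, by rw [normalProd, if_pos hc, normalProd_pair_of_contr h]; simp⟩
  · have e : m₁.op * (m₂.op * m₃.op) =
        (parSign K m₁.isOdd m₂.isOdd * parSign K m₁.isOdd m₃.isOdd) •
            ((m₂.op * m₃.op) * m₁.op) +
          ((parSign K m₁.isOdd m₂.isOdd * m₁.contr m₃) • m₂.op + m₁.contr m₂ • m₃.op) := by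
      rw [← mul_assoc, Mode.op_mul_op m₁ m₂, add_mul, smul_mul_assoc, mul_assoc,
        Mode.op_mul_op m₁ m₃, mul_add, mul_smul_comm, mul_smul_comm, mul_one, smul_mul_assoc,
        one_mul, mul_assoc]
      module
    refine ⟨-1, ?_⟩
    rw [normalProd_triple_annihilation hc, normalProd_pair_of_contr h, e]
    module

/-- As `m₁` does not contract with `g`, the relative order of `m₁` and the surviving factor is kept,
so the result is again normally ordered, with no scalar correction. This exactness is needed to
recognise `θ(x_n)` in `[Q, b_n^x]`. -/
theorem superBracket_normalProd_triple {m₁ m₂ m₃ g : Mode K ℓ} (h : m₂.contr m₃ = 0)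
    (h₁ : m₁.contr g = 0) {p : Bool} (hp : (m₁.isOdd ^^ (m₂.isOdd ^^ m₃.isOdd)) = p) :
    superBracket K (Op K ℓ) p g.isOdd (normalProd [m₁, m₂, m₃]) g.op =
      m₃.contr g • normalProd [m₁, m₂] +
        (parSign K m₃.isOdd g.isOdd * m₂.contr g) • normalProd [m₁, m₃] := by
  by_cases hc : m₁.isCreation = true
  · have e (l : List (Mode K ℓ)) : normalProd (m₁ :: l) = m₁.op * normalProd l := by
      rw [normalProd, if_pos hc]
    rw [e, e, e, normalProd_pair_of_contr h, normalProd_singleton, normalProd_singleton,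
      superBracket_mul_left _ _ _ hp, superBracket_mul_op _ _ _ rfl, superBracket_op, h₁,
      zero_smul, zero_mul, smul_zero, add_zero, mul_add, mul_smul_comm, mul_smul_comm]
  · have hp' : ((m₂.isOdd ^^ m₃.isOdd) ^^ m₁.isOdd) = p := by rw [← hp, Bool.xor_comm]
    rw [normalProd_triple_annihilation hc, normalProd_pair_annihilation hc,
      normalProd_pair_annihilation hc, normalProd_pair_of_contr h, map_smul,
      LinearMap.smul_apply, superBracket_mul_left _ _ _ hp', superBracket_mul_op _ _ _ rfl,
      superBracket_op, h₁, zero_smul, mul_zero, zero_add, add_mul, smul_mul_assoc,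
      smul_mul_assoc, smul_add, smul_add, smul_smul, smul_smul, smul_smul, smul_smul, smul_smul,
      smul_smul]
    congr 2
    · conv_rhs => rw [← parSign_mul_contr m₁.isOdd m₃ g]
      ring
    · conv_rhs => rw [← parSign_mul_contr m₁.isOdd m₂ g]
      ring

variable {ι : Type*} [Fintype ι] (B : Module.Basis ι K ℓ)

theorem diffTerm_apply_eq_zero {N : ℤ} {w : Space K ℓ} (hw : KilledFrom N w) (hN : 1 ≤ N)
    (u v : ι) (i j : ℤ) (h : N ≤ i + j ∨ N ≤ -i ∨ N ≤ -j) :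
    diffTerm B ((u, v), (i, j)) w = 0 := by
  simp only [diffTerm, LinearMap.add_apply, LinearMap.smul_apply]
  rcases h with h | h | h
  · rw [normalProd_eq_zero (m := .β (i + j) ⁅B u, B v⁆) (by simp) h _ hw,
      normalProd_eq_zero (m := .b (i + j) ⁅B u, B v⁆) (by simp) h _ hw, smul_zero, add_zero]
    all_goals exact Mode.isCreation_of_one_le (hN.trans h)
  · rw [normalProd_eq_zero (m := .γ (-i) (B.coord v)) (by simp) h _ hw,
      normalProd_eq_zero (m := .c (-i) (B.coord v)) (by simp) h _ hw, smul_zero, add_zero]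
    all_goals exact Mode.isCreation_of_one_le (hN.trans h)
  · rw [normalProd_eq_zero (m := .c (-j) (B.coord u)) (by simp) h _ hw,
      normalProd_eq_zero (m := .c (-j) (B.coord u)) (by simp) h _ hw, smul_zero, add_zero]
    all_goals exact Mode.isCreation_of_one_le (hN.trans h)

theorem locallyFinite_diffTerm : LocallyFinite (diffTerm B) := by
  refine locallyFinite_of_subset fun N hN => ?_
  -- A term that does not kill `w` has `-i < N`, `-j < N` and `i + j < N`, hence `i, j < 2 * N`.
  refine ⟨Set.univ ×ˢ (Set.Icc (-N) (2 * N) ×ˢ Set.Icc (-N) (2 * N)), Set.finite_univ.prod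
    ((Set.finite_Icc _ _).prod (Set.finite_Icc _ _)), ?_⟩
  rintro w hw ⟨⟨u, v⟩, i, j⟩ hp
  refine diffTerm_apply_eq_zero B hw hN u v i j ?_
  by_contra! h
  exact hp ⟨trivial, ⟨show -N ≤ i by omega, show i ≤ 2 * N by omega⟩,
    show -N ≤ j by omega, show j ≤ 2 * N by omega⟩

theorem diffOp_vac : diffOp B (vac K ℓ) = 0 := by
  refine opSum_apply_eq_zero fun ⟨⟨u, v⟩, i, j⟩ => ?_
  simp only [diffTerm, LinearMap.add_apply, LinearMap.smul_apply]
  -- If `i + j ≥ 0` the first factor annihilates; otherwise `i` or `j` is negative and one of the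
  -- dual factors does.
  by_cases h : 0 ≤ i + j
  · rw [normalProd_vac (m := .β (i + j) ⁅B u, B v⁆) (by simp),
      normalProd_vac (m := .b (i + j) ⁅B u, B v⁆) (by simp), smul_zero, add_zero]
    all_goals simp [Mode.isCreation]; omega
  by_cases h' : i < 0
  · rw [normalProd_vac (m := .γ (-i) (B.coord v)) (by simp),
      normalProd_vac (m := .c (-i) (B.coord v)) (by simp), smul_zero, add_zero]
    all_goals simp [Mode.isCreation]; omega
  · rw [normalProd_vac (m := .c (-j) (B.coord u)) (by simp),
      normalProd_vac (m := .c (-j) (B.coord u)) (by simp), smul_zero, add_zero]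
    all_goals simp [Mode.isCreation]; omega

theorem superBracket_mul_mul_op (m₁ m₂ m₃ g : Mode K ℓ) {p : Bool}
    (hp : (m₁.isOdd ^^ (m₂.isOdd ^^ m₃.isOdd)) = p) :
    superBracket K (Op K ℓ) p g.isOdd (m₁.op * (m₂.op * m₃.op)) g.op =
      m₁.op * (m₃.contr g • m₂.op + (parSign K m₃.isOdd g.isOdd * m₂.contr g) • m₃.op) +
        (parSign K (m₂.isOdd ^^ m₃.isOdd) g.isOdd * m₁.contr g) • (m₂.op * m₃.op) := by
  rw [superBracket_mul_left _ _ _ hp, superBracket_mul_op _ _ _ rfl, superBracket_op,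
    smul_mul_assoc, one_mul, smul_smul]

/-- The supercommutator of a term of `Q` with a symbol, up to the scalars that arise if the symbol
is some `b`. -/
theorem superBracket_diffTerm (u v : ι) (i j : ℤ) (g : Mode K ℓ)
    (hg : ∀ k f, (Mode.c k f).contr g = 0) :
    superBracket K (Op K ℓ) true g.isOdd (diffTerm B ((u, v), (i, j))) g.op =
      (Mode.β (i + j) ⁅B u, B v⁆).op * ((parSign K true g.isOdd *
          (Mode.γ (-i) (B.coord v)).contr g) • (Mode.c (-j) (B.coord u)).op) +
        (parSign K true g.isOdd * (Mode.β (i + j) ⁅B u, B v⁆).contr g) •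
          ((Mode.γ (-i) (B.coord v)).op * (Mode.c (-j) (B.coord u)).op) +
      (1 / 2 * (Mode.b (i + j) ⁅B u, B v⁆).contr g) •
          ((Mode.c (-i) (B.coord v)).op * (Mode.c (-j) (B.coord u)).op) := by
  obtain ⟨s, hs⟩ := normalProd_triple (m₁ := .β (i + j) ⁅B u, B v⁆) (m₂ := .γ (-i) (B.coord v))
    (m₃ := .c (-j) (B.coord u)) rfl
  obtain ⟨s', hs'⟩ := normalProd_triple (m₁ := .b (i + j) ⁅B u, B v⁆) (m₂ := .c (-i) (B.coord v))
    (m₃ := .c (-j) (B.coord u)) rfl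
  have h₀ : (Mode.β (i + j) ⁅B u, B v⁆).contr (Mode.c (-j) (B.coord u)) = 0 := rfl
  have hc (k : ℤ) (f : Module.Dual K ℓ) :
      superBracket K (Op K ℓ) true g.isOdd (Mode.c k f).op g.op = 0 := by
    have := superBracket_op (.c k f) g
    rwa [hg, zero_smul] at this
  simp only [diffTerm]
  rw [hs, hs', h₀]
  simp only [mul_zero, zero_smul, add_zero, map_add, map_smul, LinearMap.add_apply,
    LinearMap.smul_apply, hc, smul_zero]
  rw [superBracket_mul_mul_op (p := true) _ _ _ _ rfl,
    superBracket_mul_mul_op (p := true) _ _ _ _ rfl]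
  simp [hg, Mode.isOdd, smul_smul]

theorem diffTerm_c (u v : ι) (i j k : ℤ) (f : Module.Dual K ℓ) :
    superBracket K (Op K ℓ) true true (diffTerm B ((u, v), (i, j))) (cOp k f) =
      (1 / 2 * if i + j + k = 0 then f ⁅B u, B v⁆ else 0) •
        ((Mode.c (-i) (B.coord v)).op * (Mode.c (-j) (B.coord u)).op) := by
  refine (superBracket_diffTerm B u v i j (.c k f) fun _ _ => rfl).trans ?_
  simp [Mode.contr]

theorem diffTerm_γ (u v : ι) (i j k : ℤ) (f : Module.Dual K ℓ) :
    superBracket K (Op K ℓ) true false (diffTerm B ((u, v), (i, j))) (γOp k f) =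
      (if i + j + k = 0 then -f ⁅B u, B v⁆ else 0) •
        ((Mode.γ (-i) (B.coord v)).op * (Mode.c (-j) (B.coord u)).op) := by
  refine (superBracket_diffTerm B u v i j (.γ k f) fun _ _ => rfl).trans ?_
  simp [Mode.contr, Mode.isOdd]

theorem diffTerm_β (u v : ι) (i j k : ℤ) (x : ℓ) :
    superBracket K (Op K ℓ) true false (diffTerm B ((u, v), (i, j))) (βOp k x) =
      (if -i + k = 0 then B.coord v x else 0) •
        ((Mode.β (i + j) ⁅B u, B v⁆).op * (Mode.c (-j) (B.coord u)).op) := by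
  refine (superBracket_diffTerm B u v i j (.β k x) fun _ _ => rfl).trans ?_
  simp [Mode.contr, Mode.isOdd]

/-- `[Q, c]` is a sum of products `c c`, so only `b` can contract with it. In the same way `[Q, γ]`
consists of products `γ c`, and `[Q, β]` of products `β c`. -/
theorem diffOp_c_comm (k : ℤ) (f : Module.Dual K ℓ) (g : Mode K ℓ)
    (hg : ∀ k f, (Mode.c k f).contr g = 0) :
    superBracket K (Op K ℓ) false g.isOdd
      (superBracket K (Op K ℓ) true true (diffOp B) (cOp k f)) g.op = 0 := by
  have h := locallyFinite_diffTerm B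
  rw [diffOp, superBracket_opSum h]
  refine superBracket_opSum_eq_zero (h.superBracket _ _ _) _ _ _ fun ⟨⟨u, v⟩, i, j⟩ => ?_
  rw [diffTerm_c, map_smul, LinearMap.smul_apply, superBracket_mul_op (p := false) _ _ _ rfl]
  simp [hg]

theorem diffOp_γ_comm (k : ℤ) (f : Module.Dual K ℓ) (g : Mode K ℓ)
    (hg : ∀ k f, (Mode.c k f).contr g = 0) (hg' : ∀ k f, (Mode.γ k f).contr g = 0) :
    superBracket K (Op K ℓ) true g.isOdd
      (superBracket K (Op K ℓ) true false (diffOp B) (γOp k f)) g.op = 0 := by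
  have h := locallyFinite_diffTerm B
  rw [diffOp, superBracket_opSum h]
  refine superBracket_opSum_eq_zero (h.superBracket _ _ _) _ _ _ fun ⟨⟨u, v⟩, i, j⟩ => ?_
  rw [diffTerm_γ, map_smul, LinearMap.smul_apply, superBracket_mul_op (p := true) _ _ _ rfl]
  simp [hg, hg']

theorem diffOp_β_comm (k : ℤ) (x : ℓ) (g : Mode K ℓ)
    (hg : ∀ k f, (Mode.c k f).contr g = 0) (hg' : ∀ k x, (Mode.β k x).contr g = 0) :
    superBracket K (Op K ℓ) true g.isOdd
      (superBracket K (Op K ℓ) true false (diffOp B) (βOp k x)) g.op = 0 := by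
  have h := locallyFinite_diffTerm B
  rw [diffOp, superBracket_opSum h]
  refine superBracket_opSum_eq_zero (h.superBracket _ _ _) _ _ _ fun ⟨⟨u, v⟩, i, j⟩ => ?_
  rw [diffTerm_β, map_smul, LinearMap.smul_apply, superBracket_mul_op (p := true) _ _ _ rfl]
  simp [hg, hg']

/-- The two contractions fix both modes, `i = m` and `j = -n - m`; the finite sum left over expands
the functional `f ∘ ad x`, the sign being absorbed by antisymmetry of the Lie bracket. -/
theorem diffOp_γ_β (n m : ℤ) (f : Module.Dual K ℓ) (x : ℓ) :
    superBracket K (Op K ℓ) true false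
      (superBracket K (Op K ℓ) true false (diffOp B) (γOp n f)) (βOp m x) =
        cOp (n + m) (f ∘ₗ (LieAlgebra.ad K ℓ x : ℓ →ₗ[K] ℓ)) := by
  have h := locallyFinite_diffTerm B
  have key (u v : ι) (i j : ℤ) : superBracket K (Op K ℓ) true false
      (superBracket K (Op K ℓ) true false (diffTerm B ((u, v), (i, j))) (γOp n f)) (βOp m x) =
      if (i, j) = (m, -n - m) then
        B.coord v x • f ⁅B v, B u⁆ • cOp (n + m) (B.coord u) else 0 := by
    rw [diffTerm_γ, map_smul, LinearMap.smul_apply]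
    refine (congrArg _ (superBracket_mul_op (p := true) _ _ (.β m x) rfl)).trans ?_
    have e : (i, j) = (m, -n - m) ↔ i + j + n = 0 ∧ -i + m = 0 := by
      rw [Prod.mk.injEq]; omega
    by_cases h₁ : i + j + n = 0
    · by_cases h₂ : -i + m = 0
      · rw [if_pos (e.2 ⟨h₁, h₂⟩), show n + m = -j by omega]
        have hl : f ⁅B v, B u⁆ = -f ⁅B u, B v⁆ := by rw [← lie_skew, map_neg]
        simp [Mode.contr, Mode.isOdd, h₁, h₂, smul_smul, mul_comm, op_c, hl]
      · simp [Mode.contr, e, h₂]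
    · simp [e, h₁]
  rw [diffOp, superBracket_opSum h, superBracket_opSum (h.superBracket _ _ _),
    opSum_prod ((h.superBracket _ _ _).superBracket _ _ _) (m, -n - m)]
  · simp only [key, if_true]
    rw [Fintype.sum_prod_type, ← sum_dual_smul B (cOp (n + m))]
    refine Finset.sum_congr rfl fun u _ => ?_
    exact sum_coord_smul B ((LinearMap.toSpanSingleton K (Op K ℓ) (cOp (n + m) (B.coord u)) ∘ₗ
      f) ∘ₗ (LieAlgebra.ad K ℓ : ℓ →ₗ[K] Module.End K ℓ).flip (B u)) x
  · rintro ⟨u, v⟩ ⟨i, j⟩ hij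
    rw [key, if_neg hij]

/-- Regrouping of the indices of `Q`. -/
def diffIndexEquiv (ι : Type*) : (ι × ℤ) × (ι × ℤ) ≃ (ι × ι) × (ℤ × ℤ) where
  toFun q := ((q.1.1, q.2.1), (q.2.2, q.1.2))
  invFun p := ((p.1.1, p.2.2), (p.1.2, p.2.1))
  left_inv _ := rfl
  right_inv _ := rfl

/-- Provides local finiteness of the even and odd parts of `[Q, b_n^x]` separately, so that the sum
may be split and reindexed. -/
theorem locallyFinite_fiber {I J A : Type*} [Finite I] {f : (I × J) × A → Op K ℓ} (j : J)
    (h : ∀ i k a, k ≠ j → f ((i, k), a) = 0) (hf : ∀ i, LocallyFinite fun a => f ((i, j), a)) :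
    LocallyFinite f := fun w => by
  refine (Set.finite_iUnion fun i => (hf i w).image fun a => ((i, j), a)).subset ?_
  rintro ⟨⟨i, k⟩, a⟩ hi
  have hk : k = j := by
    by_contra hk
    exact hi (by simp [h i k a hk])
  subst hk
  exact Set.mem_iUnion.2 ⟨i, a, hi, rfl⟩

/-- Whether a symbol creates depends on its mode number alone, so normal ordering is linear in `x`,
although `Mode` carries no linear structure. -/
theorem normalProd_pair_linear (m : Mode K ℓ) (n : ℤ) :
    (∃ F : ℓ →ₗ[K] Op K ℓ, ∀ x, normalProd [.β n x, m] = F x) ∧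
      ∃ F : ℓ →ₗ[K] Op K ℓ, ∀ x, normalProd [.b n x, m] = F x := by
  by_cases h : n ≤ -1
  · refine ⟨⟨LinearMap.mulRight K m.op ∘ₗ βOp n, fun x => ?_⟩,
      LinearMap.mulRight K m.op ∘ₗ bOp n, fun x => ?_⟩ <;>
    · rw [normalProd, if_pos (by simpa [Mode.isCreation] using h), normalProd_singleton]
      rfl
  · refine ⟨⟨LinearMap.mulLeft K m.op ∘ₗ βOp n, fun x => ?_⟩,
      parSign K true m.isOdd • (LinearMap.mulLeft K m.op ∘ₗ bOp n), fun x => ?_⟩ <;>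
    · rw [normalProd_pair_annihilation (by simpa [Mode.isCreation] using h)]
      simp [Mode.isOdd, op_β, op_b]

theorem locallyFinite_normalProd_pair (x : ι → ℓ) (n : ℤ) (a : K) :
    LocallyFinite (fun p : ι × ℤ =>
      a • normalProd [.β (p.2 + n) (x p.1), .γ (-p.2) (B.coord p.1)]) ∧
    LocallyFinite (fun p : ι × ℤ =>
      a • normalProd [.b (p.2 + n) (x p.1), .c (-p.2) (B.coord p.1)]) := by
  constructor <;>
  · refine locallyFinite_of_window fun N hN => ⟨N + |n|, fun w hw u m hm => ?_⟩
    have := abs_le.1 (le_refl |n|)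
    rw [LinearMap.smul_apply]
    rcases hm with hm | hm
    · rw [normalProd_eq_zero (List.mem_cons_of_mem _ List.mem_cons_self) _
        (Mode.isCreation_of_one_le _) hw, smul_zero] <;>
      · change _ ≤ -m
        omega
    · rw [normalProd_eq_zero List.mem_cons_self _
        (Mode.isCreation_of_one_le _) hw, smul_zero] <;>
      · change _ ≤ m + n
        omega

/-- The part of the supercommutator of `Q` with `bₙˣ` coming from the `β`'s and `γ`'s. -/
def evenPart (n : ℤ) (x : ℓ) (q : (ι × ℤ) × (ι × ℤ)) : Op K ℓ :=
  (if q.1.2 = n then B.coord q.1.1 x else 0) •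
    normalProd [.β (q.2.2 + q.1.2) ⁅B q.1.1, B q.2.1⁆, .γ (-q.2.2) (B.coord q.2.1)]

/-- The part of the supercommutator of `Q` with `bₙˣ` coming from one of the `c`'s. -/
def oddPart (n : ℤ) (x : ℓ) (q : (ι × ℤ) × (ι × ℤ)) : Op K ℓ :=
  (if q.1.2 = n then B.coord q.1.1 x else 0) •
    normalProd [.b (q.2.2 + q.1.2) ⁅B q.1.1, B q.2.1⁆, .c (-q.2.2) (B.coord q.2.1)]

theorem evenPart_eq_zero (n : ℤ) (x : ℓ) (u : ι) (k : ℤ) (a : ι × ℤ) (hk : k ≠ n) :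
    evenPart B n x ((u, k), a) = 0 := by simp [evenPart, hk]

theorem oddPart_eq_zero (n : ℤ) (x : ℓ) (u : ι) (k : ℤ) (a : ι × ℤ) (hk : k ≠ n) :
    oddPart B n x ((u, k), a) = 0 := by simp [oddPart, hk]

theorem locallyFinite_evenPart (n : ℤ) (x : ℓ) : LocallyFinite (evenPart B n x) :=
  locallyFinite_fiber n (evenPart_eq_zero B n x) fun u => by
    simp only [evenPart, if_true]
    exact (locallyFinite_normalProd_pair B (fun v => ⁅B u, B v⁆) n (B.coord u x)).1

theorem locallyFinite_oddPart (n : ℤ) (x : ℓ) : LocallyFinite (oddPart B n x) :=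
  locallyFinite_fiber n (oddPart_eq_zero B n x) fun u => by
    simp only [oddPart, if_true]
    exact (locallyFinite_normalProd_pair B (fun v => ⁅B u, B v⁆) n (B.coord u x)).2

/-- In `b c c` either `c` can be contracted. The two results differ by the exchange of `(u, j)` and
`(v, i)`: the sign from the anticommuting `c`'s cancels the sign from `⁅u, v⁆ = -⁅v, u⁆`. -/
theorem diffTerm_b (n : ℤ) (x : ℓ) (q : (ι × ℤ) × (ι × ℤ)) :
    superBracket K (Op K ℓ) true true (diffTerm B (diffIndexEquiv ι q)) (bOp n x) =
      evenPart B n x q + ((1 / 2 : K) • oddPart B n x q + (1 / 2 : K) • oddPart B n x q.swap) := by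
  obtain ⟨⟨u, j⟩, v, i⟩ := q
  obtain ⟨F, hF⟩ := (normalProd_pair_linear (.c (-j) (B.coord u)) (i + j)).2
  have e₁ := superBracket_normalProd_triple (p := true) (m₁ := .β (i + j) ⁅B u, B v⁆)
    (m₂ := .γ (-i) (B.coord v)) (m₃ := .c (-j) (B.coord u)) (g := .b n x) rfl rfl rfl
  have e₂ := superBracket_normalProd_triple (p := true) (m₁ := .b (i + j) ⁅B u, B v⁆)
    (m₂ := .c (-i) (B.coord v)) (m₃ := .c (-j) (B.coord u)) (g := .b n x) rfl rfl rfl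
  have e : superBracket K (Op K ℓ) true true (diffTerm B (diffIndexEquiv ι ((u, j), (v, i))))
      (bOp n x) = superBracket K (Op K ℓ) true true
        (normalProd [.β (i + j) ⁅B u, B v⁆, .γ (-i) (B.coord v), .c (-j) (B.coord u)]) (bOp n x) +
      (1 / 2 : K) • superBracket K (Op K ℓ) true true
        (normalProd [.b (i + j) ⁅B u, B v⁆, .c (-i) (B.coord v), .c (-j) (B.coord u)])
          (bOp n x) := by
    rw [← LinearMap.smul_apply, ← map_smul, ← LinearMap.add_apply, ← map_add]
    rfl
  rw [e]
  refine (congrArg₂ (fun a b => a + (1 / 2 : K) • b) e₁ e₂).trans ?_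
  simp only [evenPart, oddPart, Prod.swap]
  rw [add_comm j i, hF, hF, ← lie_skew (B v) (B u), map_neg]
  simp only [Mode.contr, Mode.isOdd, neg_add_eq_zero, parSign_true, zero_smul, add_zero, mul_zero]
  module

theorem sum_evenPart_add_oddPart (n : ℤ) (x : ℓ) (a : ι × ℤ) :
    ∑ u, (evenPart B n x ((u, n), a) + oddPart B n x ((u, n), a)) = thetaTerm B x n a := by
  obtain ⟨v, i⟩ := a
  obtain ⟨F, hF⟩ := (normalProd_pair_linear (.γ (-i) (B.coord v)) (i + n)).1
  obtain ⟨F', hF'⟩ := (normalProd_pair_linear (.c (-i) (B.coord v)) (i + n)).2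
  simp only [evenPart, oddPart, thetaTerm, if_true, add_comm n i, hF, hF']
  rw [Finset.sum_add_distrib]
  exact congrArg₂ _
    (sum_coord_smul B (F ∘ₗ (LieAlgebra.ad K ℓ : ℓ →ₗ[K] Module.End K ℓ).flip (B v)) x)
    (sum_coord_smul B (F' ∘ₗ (LieAlgebra.ad K ℓ : ℓ →ₗ[K] Module.End K ℓ).flip (B v)) x)

/-- After reindexing by the swap, the two halves of the odd part add up to one whole. The
contraction fixes one mode to be `n`, and summing over `u` replaces `⁅u, v⁆` by `⁅x, v⁆`. -/
theorem diffOp_b [CharZero K] (n : ℤ) (x : ℓ) :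
    superBracket K (Op K ℓ) true true (diffOp B) (bOp n x) = thetaOp B x n := by
  have hQ := (locallyFinite_diffTerm B).superBracket true true (bOp n x)
  have hG := locallyFinite_evenPart B n x
  have hH := locallyFinite_oddPart B n x
  have hH' : LocallyFinite fun q : (ι × ℤ) × (ι × ℤ) => oddPart B n x q.swap := fun w =>
    (hH w).preimage (Prod.swap_injective.injOn)
  have hs : opSum (fun q : (ι × ℤ) × (ι × ℤ) => oddPart B n x q.swap) = opSum (oddPart B n x) :=
    opSum_comp_equiv (Equiv.prodComm _ _) hH
  have h₁ : opSum (fun q : (ι × ℤ) × (ι × ℤ) => (1 / 2 : K) • oddPart B n x q + (1 / 2 : K) • oddPart B n x q.swap) =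
      opSum (oddPart B n x) := by
    rw [opSum_add (hH.smul _) (hH'.smul _), opSum_smul hH, opSum_smul hH', hs, ← add_smul,
      add_halves, one_smul]
  have h₂ : superBracket K (Op K ℓ) true true (diffOp B) (bOp n x) =
      opSum (fun q => evenPart B n x q + oddPart B n x q) := by
    rw [diffOp, superBracket_opSum (locallyFinite_diffTerm B),
      ← opSum_comp_equiv (diffIndexEquiv ι) hQ]
    simp only [diffTerm_b]
    rw [opSum_add hG ((hH.smul _).add (hH'.smul _)), h₁, opSum_add hG hH]
  rw [h₂, opSum_fiber (hG.add hH) n fun u k a hk => by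
    rw [evenPart_eq_zero B n x u k a hk, oddPart_eq_zero B n x u k a hk, add_zero]]
  simp only [sum_evenPart_add_oddPart]
  rfl

end Differential

/-! ### The grading by `L_0` and the vanishing criterion for homogeneous operators. -/

section Weights

set_option linter.unusedSectionVars false

variable {K ℓ : Type*} [Field K] [LieRing ℓ] [LieAlgebra K ℓ]

attribute [local instance] opAddCommGroup

variable {ι : Type*} [Fintype ι] (B : Module.Basis ι K ℓ)

theorem virOp_b (n k : ℤ) (x : ℓ) :
    superBracket K (Op K ℓ) false true (virOp B n) (bOp k x) = (-k : K) • bOp (n + k) x := by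
  rw [virOp_eq, gradOp_b, LinearMap.id_apply]

theorem virOp_β (n k : ℤ) (x : ℓ) :
    superBracket K (Op K ℓ) false false (virOp B n) (βOp k x) = (-k : K) • βOp (n + k) x := by
  rw [virOp_eq, gradOp_β, LinearMap.id_apply]

theorem virOp_c (n k : ℤ) (f : Module.Dual K ℓ) :
    superBracket K (Op K ℓ) false true (virOp B n) (cOp k f) =
      (-(n + k) : K) • cOp (n + k) f := by
  rw [virOp_eq, gradOp_c, LinearMap.comp_id]
  congr 1
  push_cast
  ring

theorem virOp_γ (n k : ℤ) (f : Module.Dual K ℓ) :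
    superBracket K (Op K ℓ) false false (virOp B n) (γOp k f) =
      (-(n + k) : K) • γOp (n + k) f := by
  rw [virOp_eq, gradOp_γ, LinearMap.comp_id]
  congr 1
  push_cast
  ring

theorem virOp_vac : virOp B 0 (vac K ℓ) = 0 := by rw [virOp_eq, gradOp_vac]

theorem thetaOp_vac (x : ℓ) : thetaOp B x 0 (vac K ℓ) = 0 := by rw [thetaOp_eq, gradOp_vac]

theorem thetaOp_b (x y : ℓ) (n k : ℤ) :
    superBracket K (Op K ℓ) false true (thetaOp B x n) (bOp k y) = bOp (n + k) ⁅x, y⁆ := by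
  rw [thetaOp_eq, gradOp_b, one_smul, LieAlgebra.ad_apply]

theorem thetaOp_β (x y : ℓ) (n k : ℤ) :
    superBracket K (Op K ℓ) false false (thetaOp B x n) (βOp k y) = βOp (n + k) ⁅x, y⁆ := by
  rw [thetaOp_eq, gradOp_β, one_smul, LieAlgebra.ad_apply]

theorem thetaOp_c (x : ℓ) (f : Module.Dual K ℓ) (n k : ℤ) :
    superBracket K (Op K ℓ) false true (thetaOp B x n) (cOp k f) =
      (-1 : K) • cOp (n + k) (f ∘ₗ (LieAlgebra.ad K ℓ x : ℓ →ₗ[K] ℓ)) := by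
  rw [thetaOp_eq, gradOp_c]

theorem thetaOp_γ (x : ℓ) (f : Module.Dual K ℓ) (n k : ℤ) :
    superBracket K (Op K ℓ) false false (thetaOp B x n) (γOp k f) =
      (-1 : K) • γOp (n + k) (f ∘ₗ (LieAlgebra.ad K ℓ x : ℓ →ₗ[K] ℓ)) := by
  rw [thetaOp_eq, gradOp_γ]

/-- The operator `X` lowers the eigenvalues of `L₀` by `n`. -/
def HasWeight (n : ℤ) (X : Op K ℓ) : Prop :=
  superBracket K (Op K ℓ) false false (virOp B 0) X = (-n : K) • X

variable {B}

theorem HasWeight.mul {n m : ℤ} {X Y : Op K ℓ} (hX : HasWeight B n X) (hY : HasWeight B m Y) :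
    HasWeight B (n + m) (X * Y) := by
  have h : superBracket K (Op K ℓ) false false (virOp B 0) (X * Y) =
      superBracket K (Op K ℓ) false false (virOp B 0) X * Y +
        X * superBracket K (Op K ℓ) false false (virOp B 0) Y := by
    simp only [superBracket_even_left, sub_mul, mul_sub, mul_assoc]
    abel
  rw [HasWeight, h, hX, hY, smul_mul_assoc, mul_smul_comm, ← add_smul]
  congr 1
  push_cast
  ring

theorem HasWeight.add {n : ℤ} {X Y : Op K ℓ} (hX : HasWeight B n X) (hY : HasWeight B n Y) :
    HasWeight B n (X + Y) := by
  rw [HasWeight, map_add, hX, hY, smul_add]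

theorem HasWeight.smul {n : ℤ} {X : Op K ℓ} (hX : HasWeight B n X) (a : K) :
    HasWeight B n (a • X) := by
  rw [HasWeight, map_smul, hX, smul_comm]

theorem HasWeight.one : HasWeight B 0 (1 : Op K ℓ) := by
  rw [HasWeight, superBracket_one_right]
  simp

theorem HasWeight.superBracket {n m s : ℤ} {X Y : Op K ℓ} (hX : HasWeight B n X)
    (hY : HasWeight B m Y) (p q : Bool) (hs : n + m = s) :
    HasWeight B s (superBracket K (Op K ℓ) p q X Y) := by
  subst hs
  have h : VOWA.superBracket K (Op K ℓ) p q X Y = X * Y + (-parSign K p q) • (Y * X) := by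
    rw [superBracket_apply]
    module
  rw [h]
  exact (hX.mul hY).add ((add_comm m n ▸ hY.mul hX).smul _)

theorem HasWeight.opSum {I : Type*} {f : I → Op K ℓ} (hf : LocallyFinite f) {n : ℤ}
    (h : ∀ i, HasWeight B n (f i)) : HasWeight B n (opSum f) := by
  have e (i : I) : VOWA.superBracket K (Op K ℓ) false false (f i) (virOp B 0) = (n : K) • f i := by
    rw [superBracket_swap, h i, parSign_false_left]
    module
  rw [HasWeight, superBracket_swap, superBracket_opSum hf]
  simp only [e]
  rw [opSum_smul hf, parSign_false_left]
  module

variable (B) in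
theorem hasWeight_op (m : Mode K ℓ) : HasWeight B m.idx m.op := by
  rcases m with ⟨n, x⟩ | ⟨n, f⟩ | ⟨n, x⟩ | ⟨n, f⟩
  · have h := virOp_b B 0 n x
    rw [zero_add] at h
    exact h
  · have h := virOp_c B 0 n f
    rw [zero_add, Int.cast_zero, zero_add] at h
    exact h
  · have h := virOp_β B 0 n x
    rw [zero_add] at h
    exact h
  · have h := virOp_γ B 0 n f
    rw [zero_add, Int.cast_zero, zero_add] at h
    exact h

theorem hasWeight_normalProd (l : List (Mode K ℓ)) :
    HasWeight B (l.map Mode.idx).sum (normalProd l) := by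
  induction l with
  | nil => exact HasWeight.one
  | cons m l ih =>
    rw [normalProd, List.map_cons, List.sum_cons]
    split_ifs
    · exact (hasWeight_op B m).mul ih
    · exact (add_comm m.idx _ ▸ ih.mul (hasWeight_op B m)).smul _
    · exact (add_comm m.idx _ ▸ ih.mul (hasWeight_op B m)).smul _

theorem hasWeight_normalProd_of (l : List (Mode K ℓ)) {n : ℤ} (h : (l.map Mode.idx).sum = n) :
    HasWeight B n (normalProd l) := h ▸ hasWeight_normalProd l

variable (B) in
theorem hasWeight_gradOp (p : ℤ → K) (D : ℓ →ₗ[K] ℓ) (n : ℤ) : HasWeight B n (gradOp B p D n) := by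
  refine HasWeight.opSum (locallyFinite_gradTerm B p D n) fun ⟨u, m⟩ => HasWeight.smul ?_ _
  exact (hasWeight_normalProd_of _ (by simp [Mode.idx])).add
    (hasWeight_normalProd_of _ (by simp [Mode.idx]))

variable (B) in
theorem hasWeight_virOp (n : ℤ) : HasWeight B n (virOp B n) :=
  (congrArg (HasWeight B n) (virOp_eq B n)).mpr (hasWeight_gradOp B _ _ n)

variable (B) in
theorem hasWeight_thetaOp (x : ℓ) (n : ℤ) : HasWeight B n (thetaOp B x n) :=
  (congrArg (HasWeight B n) (thetaOp_eq B x n)).mpr (hasWeight_gradOp B _ _ n)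

variable (B) in
theorem hasWeight_diffOp : HasWeight B 0 (diffOp B) := by
  refine HasWeight.opSum (locallyFinite_diffTerm B) fun ⟨⟨u, v⟩, i, j⟩ => ?_
  exact (hasWeight_normalProd_of _ (by simp [Mode.idx]; ring)).add
    ((hasWeight_normalProd_of _ (by simp [Mode.idx]; ring)).smul _)

theorem hasWeight_op_mul_op {m₁ m₂ : Mode K ℓ} {s : ℤ} (hs : m₁.idx + m₂.idx = s) :
    HasWeight B s (m₁.op * m₂.op) :=
  hs ▸ (hasWeight_op B m₁).mul (hasWeight_op B m₂)

variable (B) in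
theorem hasWeight_rOp (φ : ℓ ≃ₗ[K] Module.Dual K ℓ) : HasWeight B 0 (rOp B φ) :=
  HasWeight.opSum (locallyFinite_rTerm B φ) fun ⟨_, m⟩ => by
    rw [rTerm]
    exact (hasWeight_op_mul_op (by simp [Mode.idx])).smul _

variable (B) in
theorem hasWeight_tOp (φ : ℓ ≃ₗ[K] Module.Dual K ℓ) : HasWeight B 0 (tOp B φ) :=
  HasWeight.opSum (locallyFinite_tTerm B φ) fun ⟨_, m⟩ => by
    rw [tTerm]
    exact hasWeight_op_mul_op (by simp [Mode.idx])

theorem superBracket_eq_zero_symm {p q : Bool} {X Y : Op K ℓ}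
    (h : superBracket K (Op K ℓ) p q X Y = 0) : superBracket K (Op K ℓ) q p Y X = 0 := by
  rw [superBracket_swap, h, smul_zero, neg_zero]

theorem superBracket_mul_op_eq_zero {p s : Bool} {X : Op K ℓ} {m₁ m₂ : Mode K ℓ}
    (h₁ : superBracket K (Op K ℓ) p m₁.isOdd X m₁.op = 0)
    (h₂ : superBracket K (Op K ℓ) p m₂.isOdd X m₂.op = 0) (hs : (m₁.isOdd ^^ m₂.isOdd) = s) :
    superBracket K (Op K ℓ) s p (m₁.op * m₂.op) X = 0 := by
  rw [superBracket_mul_left _ _ _ hs, superBracket_eq_zero_symm h₁, superBracket_eq_zero_symm h₂]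
  simp

theorem superBracket_normalProd_eq_zero {p : Bool} {X : Op K ℓ} {m₁ m₂ : Mode K ℓ}
    (h : ∀ m : Mode K ℓ, superBracket K (Op K ℓ) p m.isOdd X m.op = 0)
    (hs : (m₁.isOdd ^^ m₂.isOdd) = false) :
    superBracket K (Op K ℓ) false p (normalProd [m₁, m₂]) X = 0 := by
  obtain ⟨s, e⟩ := normalProd_pair m₁ m₂
  rw [e, map_add, LinearMap.add_apply, superBracket_mul_op_eq_zero (h m₁) (h m₂) hs, map_smul,
    LinearMap.smul_apply, superBracket_one_left, smul_zero, add_zero]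

/-- A homogeneous operator that supercommutes with all symbols is zero if it has nonzero weight
or kills the vacuum. -/
theorem HasWeight.eq_zero [CharZero K] {n : ℤ} {p : Bool} {X : Op K ℓ} (hX : HasWeight B n X)
    (h : ∀ m : Mode K ℓ, VOWA.superBracket K (Op K ℓ) p m.isOdd X m.op = 0)
    (h0 : n = 0 → X (vac K ℓ) = 0) : X = 0 := by
  by_cases hn : n = 0
  · exact eq_zero_of_superBracket h (h0 hn)
  -- `L_0` is a locally finite sum of products of symbols, so `X` commutes with it; by the weight
  -- hypothesis the same commutator is `-n • X`.
  have e : VOWA.superBracket K (Op K ℓ) false p (virOp B 0) X = 0 := by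
    rw [virOp_eq, gradOp]
    refine superBracket_opSum_eq_zero (locallyFinite_gradTerm B _ _ 0) _ _ _ fun ⟨u, m⟩ => ?_
    rw [gradTerm, map_smul, LinearMap.smul_apply, map_add, LinearMap.add_apply,
      superBracket_normalProd_eq_zero h rfl, superBracket_normalProd_eq_zero h rfl, add_zero,
      smul_zero]
  rw [superBracket_even_left, ← superBracket_even_left (K := K) false, hX] at e
  exact (smul_eq_zero.1 e).resolve_left (neg_ne_zero.2 (Int.cast_ne_zero.2 hn))

/-- Functionals are written as `φ x`, so that invariance of `φ` applies to the coadjoint action on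
`c` and `γ`. -/
theorem forall_mode_of_equiv (φ : ℓ ≃ₗ[K] Module.Dual K ℓ) {p : Bool} {X : Op K ℓ}
    (hb : ∀ k x, superBracket K (Op K ℓ) p true X (bOp k x) = 0)
    (hc : ∀ k x, superBracket K (Op K ℓ) p true X (cOp k (φ x)) = 0)
    (hβ : ∀ k x, superBracket K (Op K ℓ) p false X (βOp k x) = 0)
    (hγ : ∀ k x, superBracket K (Op K ℓ) p false X (γOp k (φ x)) = 0) (m : Mode K ℓ) :
    superBracket K (Op K ℓ) p m.isOdd X m.op = 0 := by
  rcases m with ⟨n, x⟩ | ⟨n, f⟩ | ⟨n, x⟩ | ⟨n, f⟩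
  · exact hb n x
  · obtain ⟨x, rfl⟩ := φ.surjective f
    exact hc n x
  · exact hβ n x
  · obtain ⟨x, rfl⟩ := φ.surjective f
    exact hγ n x

theorem superBracket_vac {p q : Bool} {X Y : Op K ℓ} (hX : X (vac K ℓ) = 0)
    (hY : Y (vac K ℓ) = 0) : superBracket K (Op K ℓ) p q X Y (vac K ℓ) = 0 := by
  rw [superBracket_apply, LinearMap.sub_apply, LinearMap.smul_apply, Module.End.mul_apply,
    Module.End.mul_apply, hX, hY]
  simp

/-- By the Jacobi identity the order of two symbols in a double bracket matters only through the
bracket of `X` with `[m₁, m₂]`, and the latter is a scalar. -/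
theorem superBracket_superBracket_op (p : Bool) {s t : Bool} (X : Op K ℓ) (m₁ m₂ : Mode K ℓ)
    (hs : (p ^^ m₁.isOdd) = s) (ht : (p ^^ m₂.isOdd) = t) :
    superBracket K (Op K ℓ) s m₂.isOdd (superBracket K (Op K ℓ) p m₁.isOdd X m₁.op) m₂.op =
      parSign K m₁.isOdd m₂.isOdd •
        superBracket K (Op K ℓ) t m₁.isOdd (superBracket K (Op K ℓ) p m₂.isOdd X m₂.op) m₁.op := by
  have e : superBracket K (Op K ℓ) p (m₁.isOdd ^^ m₂.isOdd) X
      (superBracket K (Op K ℓ) m₁.isOdd m₂.isOdd m₁.op m₂.op) = 0 := by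
    rw [superBracket_op, map_smul]
    -- For equal parities the bracket with the scalar is an ordinary commutator; for unequal
    -- parities the scalar itself is zero.
    by_cases h : m₁.isOdd = m₂.isOdd
    · rw [h, Bool.xor_self, superBracket_one_right, smul_zero]
    · have : m₁.contr m₂ = 0 := by
        rcases m₁ with ⟨n, x⟩ | ⟨n, x⟩ | ⟨n, x⟩ | ⟨n, x⟩ <;>
          rcases m₂ with ⟨m, y⟩ | ⟨m, y⟩ | ⟨m, y⟩ | ⟨m, y⟩ <;> simp [Mode.isOdd, Mode.contr] at h ⊢
      rw [this, zero_smul]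
  subst ht
  rw [superBracket_jacobi _ _ _ hs, e, zero_sub, superBracket_swap m₁.isOdd, smul_neg, neg_neg,
    smul_smul, parSign_comm m₁.isOdd (p ^^ m₂.isOdd), parSign_xor_left, ← mul_assoc,
    parSign_mul_self, one_mul, parSign_comm m₂.isOdd]

theorem superBracket_superBracket_op_eq_zero {p : Bool} {s : Bool} {X : Op K ℓ} (m₁ m₂ : Mode K ℓ)
    (hs : (p ^^ m₁.isOdd) = s) (h : superBracket K (Op K ℓ) p m₂.isOdd X m₂.op = 0) :
    superBracket K (Op K ℓ) s m₂.isOdd (superBracket K (Op K ℓ) p m₁.isOdd X m₁.op) m₂.op = 0 := by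
  rw [superBracket_superBracket_op p X m₁ m₂ hs rfl, h]
  simp

end Weights

/-! ### Relations among the quadratic operators. -/

section Relations

set_option linter.unusedSectionVars false

variable {K ℓ : Type*} [Field K] [LieRing ℓ] [LieAlgebra K ℓ]

attribute [local instance] opAddCommGroup

variable {ι : Type*} [Fintype ι] (B : Module.Basis ι K ℓ) (φ : ℓ ≃ₗ[K] Module.Dual K ℓ)

theorem rOp_rOp (hφ : ∀ x y, φ x y = φ y x) :
    superBracket K (Op K ℓ) true true (rOp B φ) (rOp B φ) = 0 := by
  refine eq_zero_of_superBracket (p := false) (forall_mode_of_equiv φ ?_ ?_ ?_ ?_)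
    (superBracket_vac (rOp_vac B φ) (rOp_vac B φ)) <;> intro k x <;>
  · simp [superBracket_jacobi, rOp_b, rOp_c, rOp_β B φ hφ, rOp_γ]

theorem tOp_tOp (hφ : ∀ x y, φ x y = φ y x) :
    superBracket K (Op K ℓ) true true (tOp B φ) (tOp B φ) = 0 := by
  refine eq_zero_of_superBracket (p := false) (forall_mode_of_equiv φ ?_ ?_ ?_ ?_)
    (superBracket_vac (tOp_vac B φ) (tOp_vac B φ)) <;> intro k x <;>
  · simp [superBracket_jacobi, tOp_b, tOp_c, tOp_β, tOp_γ B φ hφ]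

/-- `t` carries no mode coefficient and `r` carries the mode number, so their composites multiply a
symbol by its mode number, which `L_0` does with the opposite sign. -/
theorem rOp_tOp (hφ : ∀ x y, φ x y = φ y x) :
    superBracket K (Op K ℓ) true true (rOp B φ) (tOp B φ) + virOp B 0 = 0 := by
  refine eq_zero_of_superBracket (p := false) (forall_mode_of_equiv φ ?_ ?_ ?_ ?_) ?_
  any_goals
    intro k x
    simp [superBracket_jacobi, tOp_b, tOp_c, tOp_β, tOp_γ B φ hφ, rOp_b, rOp_c, rOp_β B φ hφ, rOp_γ, virOp_b, virOp_c,
      virOp_β, virOp_γ]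
  rw [LinearMap.add_apply, superBracket_vac (rOp_vac B φ) (tOp_vac B φ), virOp_vac, add_zero]

theorem rOp_koszulOp (hφ : ∀ x y, φ x y = φ y x) :
    superBracket K (Op K ℓ) true true (rOp B φ) (koszulOp B) = 0 := by
  refine eq_zero_of_superBracket (p := false) (forall_mode_of_equiv φ ?_ ?_ ?_ ?_)
    (superBracket_vac (rOp_vac B φ) (koszulOp_vac B)) <;> intro k x <;>
  · simp [superBracket_jacobi, rOp_b, rOp_c, rOp_β B φ hφ, rOp_γ, koszulOp_b, koszulOp_c, koszulOp_β, koszulOp_γ]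

theorem rOp_homotopyOp (hφ : ∀ x y, φ x y = φ y x) :
    superBracket K (Op K ℓ) true true (rOp B φ) (homotopyOp B) = 0 := by
  refine eq_zero_of_superBracket (p := false) (forall_mode_of_equiv φ ?_ ?_ ?_ ?_)
    (superBracket_vac (rOp_vac B φ) (homotopyOp_vac B)) <;> intro k x <;>
  · simp [superBracket_jacobi, rOp_b, rOp_c, rOp_β B φ hφ, rOp_γ, homotopyOp_b, homotopyOp_c, homotopyOp_β,
      homotopyOp_γ]

theorem tOp_koszulOp (hφ : ∀ x y, φ x y = φ y x) :
    superBracket K (Op K ℓ) true true (tOp B φ) (koszulOp B) = 0 := by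
  refine eq_zero_of_superBracket (p := false) (forall_mode_of_equiv φ ?_ ?_ ?_ ?_)
    (superBracket_vac (tOp_vac B φ) (koszulOp_vac B)) <;> intro k x <;>
  · simp [superBracket_jacobi, tOp_b, tOp_c, tOp_β, tOp_γ B φ hφ, koszulOp_b, koszulOp_c, koszulOp_β, koszulOp_γ]

theorem tOp_homotopyOp (hφ : ∀ x y, φ x y = φ y x) :
    superBracket K (Op K ℓ) true true (tOp B φ) (homotopyOp B) = 0 := by
  refine eq_zero_of_superBracket (p := false) (forall_mode_of_equiv φ ?_ ?_ ?_ ?_)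
    (superBracket_vac (tOp_vac B φ) (homotopyOp_vac B)) <;> intro k x <;>
  · simp [superBracket_jacobi, tOp_b, tOp_c, tOp_β, tOp_γ B φ hφ, homotopyOp_b, homotopyOp_c, homotopyOp_β,
      homotopyOp_γ]

theorem tOp_virOp (hφ : ∀ x y, φ x y = φ y x) :
    superBracket K (Op K ℓ) true false (tOp B φ) (virOp B 0) = 0 := by
  refine eq_zero_of_superBracket (p := true) (forall_mode_of_equiv φ ?_ ?_ ?_ ?_)
    (superBracket_vac (tOp_vac B φ) (virOp_vac B)) <;> intro k x <;>
  · simp [superBracket_jacobi, tOp_b, tOp_c, tOp_β, tOp_γ B φ hφ, virOp_b, virOp_c, virOp_β, virOp_γ]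

theorem rOp_virOp [CharZero K] (hφ : ∀ x y, φ x y = φ y x) (n : ℤ) :
    superBracket K (Op K ℓ) true false (rOp B φ) (virOp B n) = 0 := by
  refine ((hasWeight_rOp B φ).superBracket (hasWeight_virOp B n) _ _ (zero_add n)).eq_zero
    (p := true) (forall_mode_of_equiv φ ?_ ?_ ?_ ?_) ?_
  any_goals
    intro k x
    simp [superBracket_jacobi, rOp_b, rOp_c, rOp_β B φ hφ, rOp_γ, virOp_b, virOp_c, virOp_β, virOp_γ]
    try module
  rintro rfl
  exact superBracket_vac (rOp_vac B φ) (virOp_vac B)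

/-- The coefficients of `r` before and after the action of `θ(y_n)` differ by `n`, so invariance of
`φ` gives cancellation in mode `0`. The operator `t` has no such coefficient, and `tOp_thetaOp`
below covers all `n`. -/
theorem rOp_thetaOp (hφ : ∀ x y, φ x y = φ y x)
    (hφ' : ∀ x y, φ x ∘ₗ (LieAlgebra.ad K ℓ y : ℓ →ₗ[K] ℓ) = φ ⁅x, y⁆) (y : ℓ) :
    superBracket K (Op K ℓ) true false (rOp B φ) (thetaOp B y 0) = 0 := by
  refine eq_zero_of_superBracket (p := true) (forall_mode_of_equiv φ ?_ ?_ ?_ ?_)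
    (superBracket_vac (rOp_vac B φ) (thetaOp_vac B y)) <;> intro k x <;>
  · have e : φ ⁅y, x⁆ = -φ ⁅x, y⁆ := by rw [← lie_skew, map_neg]
    simp [superBracket_jacobi, rOp_b, rOp_c, rOp_β B φ hφ, rOp_γ, thetaOp_b, thetaOp_c, thetaOp_β, thetaOp_γ, hφ', e,
      -lie_skew]

theorem tOp_thetaOp [CharZero K] (hφ : ∀ x y, φ x y = φ y x)
    (hφ' : ∀ x y, φ x ∘ₗ (LieAlgebra.ad K ℓ y : ℓ →ₗ[K] ℓ) = φ ⁅x, y⁆) (y : ℓ) (n : ℤ) :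
    superBracket K (Op K ℓ) true false (tOp B φ) (thetaOp B y n) = 0 := by
  refine ((hasWeight_tOp B φ).superBracket (hasWeight_thetaOp B y n) _ _ (zero_add n)).eq_zero
    (p := true) (forall_mode_of_equiv φ ?_ ?_ ?_ ?_) ?_
  any_goals
    intro k x
    have e : ⁅y, x⁆ = -⁅x, y⁆ := by rw [← lie_skew]
    simp [superBracket_jacobi, tOp_b, tOp_c, tOp_β, tOp_γ B φ hφ, thetaOp_b, thetaOp_c, thetaOp_β, thetaOp_γ, hφ', e,
      -lie_skew]
  rintro rfl
  exact superBracket_vac (tOp_vac B φ) (thetaOp_vac B y)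

end Relations

/-! ### The brackets of `Q` with `r` and `t`. -/

section Differential

set_option linter.unusedSectionVars false

variable {K ℓ : Type*} [Field K] [LieRing ℓ] [LieAlgebra K ℓ]

attribute [local instance] opAddCommGroup

variable {ι : Type*} [Fintype ι] (B : Module.Basis ι K ℓ) (φ : ℓ ≃ₗ[K] Module.Dual K ℓ)

theorem rOp_comm_eq_zero {p : Bool} {X : Op K ℓ}
    (hc : ∀ k f, superBracket K (Op K ℓ) p true X (cOp k f) = 0)
    (hγ : ∀ k f, superBracket K (Op K ℓ) p false X (γOp k f) = 0) :
    superBracket K (Op K ℓ) true p (rOp B φ) X = 0 := by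
  refine superBracket_opSum_eq_zero (locallyFinite_rTerm B φ) _ _ _ fun ⟨u, m⟩ => ?_
  have e := superBracket_mul_op_eq_zero (X := X) (p := p) (s := true)
    (m₁ := .γ (-m) (φ (B u))) (m₂ := .c m (B.coord u)) (hγ _ _) (hc _ _) rfl
  rw [rTerm, map_smul, LinearMap.smul_apply, e, smul_zero]

theorem diffOp_γ_b [CharZero K] (n m : ℤ) (f : Module.Dual K ℓ) (y : ℓ) :
    superBracket K (Op K ℓ) true true
      (superBracket K (Op K ℓ) true false (diffOp B) (γOp n f)) (bOp m y) =
        (-1 : K) • γOp (n + m) (f ∘ₗ (LieAlgebra.ad K ℓ y : ℓ →ₗ[K] ℓ)) := by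
  have h := superBracket_superBracket_op true (diffOp B) (.γ n f) (.b m y) rfl rfl
  refine h.trans ?_
  change _ • superBracket K (Op K ℓ) false false
    (superBracket K (Op K ℓ) true true (diffOp B) (bOp m y)) (γOp n f) = _
  rw [diffOp_b, thetaOp_γ, add_comm m n]
  simp [Mode.isOdd]

theorem diffOp_β_b [CharZero K] (n m : ℤ) (x y : ℓ) :
    superBracket K (Op K ℓ) true true
      (superBracket K (Op K ℓ) true false (diffOp B) (βOp n x)) (bOp m y) =
        βOp (n + m) ⁅y, x⁆ := by
  have h := superBracket_superBracket_op true (diffOp B) (.β n x) (.b m y) rfl rfl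
  refine h.trans ?_
  change _ • superBracket K (Op K ℓ) false false
    (superBracket K (Op K ℓ) true true (diffOp B) (bOp m y)) (βOp n x) = _
  rw [diffOp_b, thetaOp_β, add_comm m n]
  simp [Mode.isOdd]

theorem diffOp_c_b [CharZero K] (n m : ℤ) (f : Module.Dual K ℓ) (y : ℓ) :
    superBracket K (Op K ℓ) false true
      (superBracket K (Op K ℓ) true true (diffOp B) (cOp n f)) (bOp m y) =
        cOp (n + m) (f ∘ₗ (LieAlgebra.ad K ℓ y : ℓ →ₗ[K] ℓ)) := by
  have h := superBracket_superBracket_op true (diffOp B) (.c n f) (.b m y) rfl rfl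
  refine h.trans ?_
  change _ • superBracket K (Op K ℓ) false true
    (superBracket K (Op K ℓ) true true (diffOp B) (bOp m y)) (cOp n f) = _
  rw [diffOp_b, thetaOp_c, add_comm m n]
  simp [Mode.isOdd]

theorem diffOp_β_γ (n m : ℤ) (x : ℓ) (f : Module.Dual K ℓ) :
    superBracket K (Op K ℓ) true false
      (superBracket K (Op K ℓ) true false (diffOp B) (βOp n x)) (γOp m f) =
        cOp (n + m) (f ∘ₗ (LieAlgebra.ad K ℓ x : ℓ →ₗ[K] ℓ)) := by
  have h := superBracket_superBracket_op true (diffOp B) (.β n x) (.γ m f) rfl rfl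
  refine h.trans ?_
  change _ • superBracket K (Op K ℓ) true false
    (superBracket K (Op K ℓ) true false (diffOp B) (γOp m f)) (βOp n x) = _
  rw [diffOp_γ_β, add_comm m n]
  simp [Mode.isOdd]

theorem diffOp_c_c (n m : ℤ) (f g : Module.Dual K ℓ) :
    superBracket K (Op K ℓ) false true
      (superBracket K (Op K ℓ) true true (diffOp B) (cOp n f)) (cOp m g) = 0 :=
  diffOp_c_comm B n f (.c m g) fun _ _ => rfl

theorem diffOp_c_γ (n m : ℤ) (f g : Module.Dual K ℓ) :
    superBracket K (Op K ℓ) false false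
      (superBracket K (Op K ℓ) true true (diffOp B) (cOp n f)) (γOp m g) = 0 :=
  diffOp_c_comm B n f (.γ m g) fun _ _ => rfl

theorem diffOp_c_β (n m : ℤ) (f : Module.Dual K ℓ) (y : ℓ) :
    superBracket K (Op K ℓ) false false
      (superBracket K (Op K ℓ) true true (diffOp B) (cOp n f)) (βOp m y) = 0 :=
  diffOp_c_comm B n f (.β m y) fun _ _ => rfl

theorem diffOp_γ_c (n m : ℤ) (f g : Module.Dual K ℓ) :
    superBracket K (Op K ℓ) true true
      (superBracket K (Op K ℓ) true false (diffOp B) (γOp n f)) (cOp m g) = 0 :=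
  diffOp_γ_comm B n f (.c m g) (fun _ _ => rfl) fun _ _ => rfl

theorem diffOp_γ_γ (n m : ℤ) (f g : Module.Dual K ℓ) :
    superBracket K (Op K ℓ) true false
      (superBracket K (Op K ℓ) true false (diffOp B) (γOp n f)) (γOp m g) = 0 :=
  diffOp_γ_comm B n f (.γ m g) (fun _ _ => rfl) fun _ _ => rfl

theorem diffOp_β_c (n m : ℤ) (x : ℓ) (g : Module.Dual K ℓ) :
    superBracket K (Op K ℓ) true true
      (superBracket K (Op K ℓ) true false (diffOp B) (βOp n x)) (cOp m g) = 0 :=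
  diffOp_β_comm B n x (.c m g) (fun _ _ => rfl) fun _ _ => rfl

theorem diffOp_β_β (n m : ℤ) (x y : ℓ) :
    superBracket K (Op K ℓ) true false
      (superBracket K (Op K ℓ) true false (diffOp B) (βOp n x)) (βOp m y) = 0 :=
  diffOp_β_comm B n x (.β m y) (fun _ _ => rfl) fun _ _ => rfl

theorem hasWeight_b (n : ℤ) (x : ℓ) : HasWeight B n (bOp n x) := hasWeight_op B (.b n x)
theorem hasWeight_c (n : ℤ) (f : Module.Dual K ℓ) : HasWeight B n (cOp n f) :=
  hasWeight_op B (.c n f)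
theorem hasWeight_β (n : ℤ) (x : ℓ) : HasWeight B n (βOp n x) := hasWeight_op B (.β n x)
theorem hasWeight_γ (n : ℤ) (f : Module.Dual K ℓ) : HasWeight B n (γOp n f) :=
  hasWeight_op B (.γ n f)

theorem bOp_zero_vac (x : ℓ) : bOp 0 x (vac K ℓ) = 0 := Mode.op_vac (.b 0 x) rfl
theorem βOp_zero_vac (x : ℓ) : βOp 0 x (vac K ℓ) = 0 := Mode.op_vac (.β 0 x) rfl

/-- The brackets of `X = [Q, r]` with `c`, `γ`, `b`, `β` are shown to vanish in this order. Once
`[X, m₂] = 0` is known, `[[X, m₁], m₂] = 0` is automatic, so each case leaves fewer double brackets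
to compute. -/
theorem diffOp_rOp [CharZero K] (hφ : ∀ x y, φ x y = φ y x)
    (hφ' : ∀ x y, φ x ∘ₗ (LieAlgebra.ad K ℓ y : ℓ →ₗ[K] ℓ) = φ ⁅x, y⁆) :
    superBracket K (Op K ℓ) true true (diffOp B) (rOp B φ) = 0 := by
  obtain ⟨X, hX⟩ : ∃ X, superBracket K (Op K ℓ) true true (diffOp B) (rOp B φ) = X := ⟨_, rfl⟩
  have hXw : HasWeight B 0 X :=
    hX ▸ (hasWeight_diffOp B).superBracket (hasWeight_rOp B φ) _ _ (add_zero 0)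
  have hX0 : X (vac K ℓ) = 0 := hX ▸ superBracket_vac (diffOp_vac B) (rOp_vac B φ)
  have hc (k : ℤ) (f : Module.Dual K ℓ) : superBracket K (Op K ℓ) false true X (cOp k f) = 0 := by
    rw [← hX]
    simp [superBracket_jacobi, rOp_c]
    -- `r` is built from `γ` and `c` alone, and `[Q, c]` supercommutes with both.
    exact rOp_comm_eq_zero B φ (diffOp_c_c B k · f ·) (diffOp_c_γ B k · f ·)
  have hγ (k : ℤ) (f : Module.Dual K ℓ) : superBracket K (Op K ℓ) false false X (γOp k f) = 0 := by
    rw [← hX]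
    simp [superBracket_jacobi, rOp_γ]
    exact rOp_comm_eq_zero B φ (diffOp_γ_c B k · f ·) (diffOp_γ_γ B k · f ·)
  have hb (n : ℤ) (x : ℓ) : superBracket K (Op K ℓ) false true X (bOp n x) = 0 := by
    have hX' : superBracket K (Op K ℓ) false true X (bOp n x) =
        (-n : K) • superBracket K (Op K ℓ) true false (diffOp B) (γOp n (φ x)) +
          superBracket K (Op K ℓ) true false (rOp B φ) (thetaOp B x n) := by
      rw [← hX]
      simp [superBracket_jacobi, rOp_b, diffOp_b]
    have e (y : ℓ) : φ ⁅y, x⁆ = -φ ⁅x, y⁆ := by rw [← lie_skew, map_neg]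
    refine (hXw.superBracket (hasWeight_b B n x) _ _ (zero_add n)).eq_zero (p := true)
      (forall_mode_of_equiv φ ?_ ?_ ?_ ?_) ?_
    · intro m y
      -- The defect of `[r, θ(x_n)]`, proportional to `n`, cancels the factor `-n` in `[r, b_n^x] =
      -- -n γ_n^{φ(x)}`.
      have e₁ : superBracket K (Op K ℓ) true true
          (superBracket K (Op K ℓ) true false (rOp B φ) (thetaOp B x n)) (bOp m y) =
            (-n : K) • γOp (n + m) (φ ⁅x, y⁆) := by
        simp [superBracket_jacobi, rOp_b, thetaOp_b, thetaOp_γ, hφ', e, -lie_skew]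
        module
      rw [hX', map_add, LinearMap.add_apply, e₁, map_smul, LinearMap.smul_apply, diffOp_γ_b, hφ']
      module
    · exact fun k y => superBracket_superBracket_op_eq_zero (.b n x) (.c k (φ y)) rfl (hc _ _)
    · intro m y
      have e₁ : superBracket K (Op K ℓ) true false
          (superBracket K (Op K ℓ) true false (rOp B φ) (thetaOp B x n)) (βOp m y) =
            (n : K) • cOp (n + m) (φ ⁅x, y⁆) := by
        simp [superBracket_jacobi, rOp_β B φ hφ, thetaOp_β, thetaOp_c, hφ', e, -lie_skew]
        module
      rw [hX', map_add, LinearMap.add_apply, e₁, map_smul, LinearMap.smul_apply, diffOp_γ_β, hφ']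
      module
    · exact fun k y => superBracket_superBracket_op_eq_zero (.b n x) (.γ k (φ y)) rfl (hγ _ _)
    -- The vacuum matters only in weight zero, and `b_0^x` annihilates it.
    · rintro rfl
      exact superBracket_vac hX0 (bOp_zero_vac x)
  have hβ (n : ℤ) (x : ℓ) : superBracket K (Op K ℓ) false false X (βOp n x) = 0 := by
    have hX' : superBracket K (Op K ℓ) false false X (βOp n x) =
        (n : K) • superBracket K (Op K ℓ) true true (diffOp B) (cOp n (φ x)) +
          superBracket K (Op K ℓ) true true (rOp B φ)
            (superBracket K (Op K ℓ) true false (diffOp B) (βOp n x)) := by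
      rw [← hX]
      simp [superBracket_jacobi, rOp_β B φ hφ]
    refine (hXw.superBracket (hasWeight_β B n x) _ _ (zero_add n)).eq_zero (p := false)
      (forall_mode_of_equiv φ ?_ ?_ ?_ ?_) ?_
    · exact fun k y => superBracket_superBracket_op_eq_zero (.β n x) (.b k y) rfl (hb _ _)
    · exact fun k y => superBracket_superBracket_op_eq_zero (.β n x) (.c k (φ y)) rfl (hc _ _)
    · intro m y
      rw [hX', map_add, LinearMap.add_apply, map_smul, LinearMap.smul_apply, diffOp_c_β,
        superBracket_jacobi (K := K) true true false (Bool.xor_self true), diffOp_β_β,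
        rOp_β B φ hφ]
      simp [diffOp_β_c]
    · exact fun k y => superBracket_superBracket_op_eq_zero (.β n x) (.γ k (φ y)) rfl (hγ _ _)
    · rintro rfl
      exact superBracket_vac hX0 (βOp_zero_vac x)
  rw [hX]
  exact eq_zero_of_superBracket (forall_mode_of_equiv φ hb (fun _ _ => hc _ _) hβ
    fun _ _ => hγ _ _) hX0

/-- Needed because `c_0` is a creation operator, so the weight zero case is not automatic. Here `t`
replaces one `c` of `c_k c_{-k}` by a `β`, and in the commuting pair `β_k`, `c_{-k}` one factor
always annihilates. -/
theorem tOp_comp_diffOp_c_vac (f : Module.Dual K ℓ) :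
    tOp B φ (superBracket K (Op K ℓ) true true (diffOp B) (cOp 0 f) (vac K ℓ)) = 0 := by
  have h := (locallyFinite_diffTerm B).superBracket true true (cOp 0 f)
  have ht (g : Module.Dual K ℓ) (k : ℤ) (w : Space K ℓ) :
      tOp B φ (cOp k g w) = βOp k (φ.symm g) w - cOp k g (tOp B φ w) := by
    rw [← tOp_c B φ k g, superBracket_odd]
    simp
  have hβ (k : ℤ) (x : ℓ) (g : Module.Dual K ℓ) : (βOp k x) (cOp (-k) g (vac K ℓ)) = 0 :=
    op_mul_op_vac (m₁ := .β k x) (m₂ := .c (-k) g) rfl (by simp [Mode.isCreation]; omega)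
  have hc (k : ℤ) (x : ℓ) (g : Module.Dual K ℓ) : cOp k g (βOp (-k) x (vac K ℓ)) = 0 :=
    op_mul_op_vac (m₁ := .c k g) (m₂ := .β (-k) x) rfl (by simp [Mode.isCreation]; omega)
  rw [diffOp, superBracket_opSum (locallyFinite_diffTerm B), ← Module.End.mul_apply,
    ← opSum_mul_left h]
  refine opSum_apply_eq_zero fun ⟨⟨u, v⟩, i, j⟩ => ?_
  rw [diffTerm_c, Module.End.mul_apply, LinearMap.smul_apply, map_smul]
  split_ifs with hij
  · obtain rfl : i = -j := by omega
    rw [Module.End.mul_apply, op_c, op_c, ht, ht, tOp_vac, map_zero, sub_zero, neg_neg, hβ]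
    have := hc j (φ.symm (B.coord u)) (B.coord v)
    rw [this]
    simp
  · simp

/-- An antisymmetric array paired with a symmetric one: the sum equals its own negative. -/
theorem sum_lie_symm_eq_zero [CharZero K] (f : Module.Dual K ℓ) (G : ι → ι → K)
    (hG : ∀ u v, G u v = G v u) : ∑ u, ∑ v, f ⁅B u, B v⁆ * G u v = 0 := by
  refine self_eq_neg.1 ?_
  conv_lhs => rw [Finset.sum_comm]
  rw [← Finset.sum_neg_distrib]
  refine Finset.sum_congr rfl fun u _ => ?_
  rw [← Finset.sum_neg_distrib]
  refine Finset.sum_congr rfl fun v _ => ?_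
  rw [← lie_skew, map_neg, hG, neg_mul]

/-- On the vacuum only the terms `γ_0 c_0` survive. Applying `t` replaces `γ_0` by `-b_0`, which
contracts with `c_0` to a value of the symmetric form `φ⁻¹`; the term with `β_0` dies. The
coefficients `f ⁅u, v⁆` are antisymmetric, so the sum vanishes. -/
theorem tOp_comp_diffOp_γ_vac [CharZero K] (hφ : ∀ x y, φ x y = φ y x) (f : Module.Dual K ℓ) :
    tOp B φ (superBracket K (Op K ℓ) true false (diffOp B) (γOp 0 f) (vac K ℓ)) = 0 := by
  have h := (locallyFinite_diffTerm B).superBracket true false (γOp 0 f)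
  have htc (g : Module.Dual K ℓ) (k : ℤ) (w : Space K ℓ) :
      tOp B φ (cOp k g w) = βOp k (φ.symm g) w - cOp k g (tOp B φ w) := by
    rw [← tOp_c B φ k g, superBracket_odd]
    simp
  have htγ (g : Module.Dual K ℓ) (k : ℤ) (w : Space K ℓ) :
      tOp B φ (γOp k g w) = (-1 : K) • bOp k (φ.symm g) w + γOp k g (tOp B φ w) := by
    rw [← LinearMap.smul_apply, ← tOp_γ B φ hφ k g, superBracket_even_right]
    simp
  have hbc (x : ℓ) (g : Module.Dual K ℓ) : bOp 0 x (cOp 0 g (vac K ℓ)) = g x • vac K ℓ := by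
    have := Mode.op_op (.b 0 x) (.c 0 g) (vac K ℓ)
    rw [op_b, op_c, bOp_zero_vac, map_zero, smul_zero, zero_add] at this
    simpa [Mode.contr] using this
  have hs (u v : ι) : B.coord u (φ.symm (B.coord v)) = B.coord v (φ.symm (B.coord u)) := by
    have := hφ (φ.symm (B.coord u)) (φ.symm (B.coord v))
    rwa [φ.apply_symm_apply, φ.apply_symm_apply] at this
  rw [diffOp, superBracket_opSum (locallyFinite_diffTerm B), ← Module.End.mul_apply,
    ← opSum_mul_left h, opSum_apply_prod (h.mul_left _) (0, 0)]
  · have key (q : ι × ι) : (tOp B φ * superBracket K (Op K ℓ) true false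
        (diffTerm B (q, (0, 0))) (γOp 0 f)) (vac K ℓ) =
          (f ⁅B q.1, B q.2⁆ * B.coord q.1 (φ.symm (B.coord q.2))) • vac K ℓ := by
      obtain ⟨u, v⟩ := q
      rw [diffTerm_γ, Module.End.mul_apply, LinearMap.smul_apply, map_smul, Module.End.mul_apply,
        op_c, op_γ, neg_zero, htγ, htc, tOp_vac, map_zero, sub_zero, βOp_zero_vac, map_zero,
        hbc]
      simp [smul_smul]
    simp only [key]
    rw [← Finset.sum_smul, Fintype.sum_prod_type,
      sum_lie_symm_eq_zero B f (fun u v => B.coord u (φ.symm (B.coord v))) hs, zero_smul]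
  · rintro ⟨u, v⟩ ⟨i, j⟩ hij
    rw [diffTerm_γ, Module.End.mul_apply, LinearMap.smul_apply]
    split_ifs with h'
    · rw [op_mul_op_vac rfl]
      · simp
      · have : i ≠ 0 := fun hi => hij (by rw [Prod.mk.injEq]; omega)
        simp [Mode.isCreation]
        omega
    · simp

/-- Here the order is `b`, `β`, `c`, `γ`, starting from `[X, b] = 0`, which holds because `t`
commutes with every `θ(x_n)`. For `c` and `γ` the double brackets cancel by invariance of `φ`. -/
theorem diffOp_tOp [CharZero K] (hφ : ∀ x y, φ x y = φ y x)
    (hφ' : ∀ x y, φ x ∘ₗ (LieAlgebra.ad K ℓ y : ℓ →ₗ[K] ℓ) = φ ⁅x, y⁆) :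
    superBracket K (Op K ℓ) true true (diffOp B) (tOp B φ) = 0 := by
  obtain ⟨X, hX⟩ : ∃ X, superBracket K (Op K ℓ) true true (diffOp B) (tOp B φ) = X := ⟨_, rfl⟩
  have hXw : HasWeight B 0 X :=
    hX ▸ (hasWeight_diffOp B).superBracket (hasWeight_tOp B φ) _ _ (add_zero 0)
  have hX0 : X (vac K ℓ) = 0 := hX ▸ superBracket_vac (diffOp_vac B) (tOp_vac B φ)
  have e (x y : ℓ) : ⁅y, x⁆ = -⁅x, y⁆ := (lie_skew y x).symm
  have hb (n : ℤ) (x : ℓ) : superBracket K (Op K ℓ) false true X (bOp n x) = 0 := by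
    rw [← hX]
    simp [superBracket_jacobi, tOp_b, diffOp_b, tOp_thetaOp B φ hφ hφ']
  have hβ (n : ℤ) (x : ℓ) : superBracket K (Op K ℓ) false false X (βOp n x) = 0 := by
    have hX' : superBracket K (Op K ℓ) false false X (βOp n x) =
        superBracket K (Op K ℓ) true true (tOp B φ)
          (superBracket K (Op K ℓ) true false (diffOp B) (βOp n x)) := by
      rw [← hX]
      simp [superBracket_jacobi, tOp_β]
    refine (hXw.superBracket (hasWeight_β B n x) _ _ (zero_add n)).eq_zero (p := false)
      (forall_mode_of_equiv φ ?_ ?_ ?_ ?_) ?_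
    · exact fun k y => superBracket_superBracket_op_eq_zero (.β n x) (.b k y) rfl (hb _ _)
    · intro m y
      rw [hX', superBracket_jacobi (K := K) true true true (Bool.xor_self true), diffOp_β_c, tOp_c]
      simp [diffOp_β_β]
    · intro m y
      rw [hX', superBracket_jacobi (K := K) true true false (Bool.xor_self true), diffOp_β_β,
        tOp_β]
      simp
    · intro m y
      rw [hX', superBracket_jacobi (K := K) true true false (Bool.xor_self true), diffOp_β_γ,
        tOp_γ B φ hφ, hφ']
      simp [tOp_c, diffOp_β_b]
    · rintro rfl
      exact superBracket_vac hX0 (βOp_zero_vac x)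
  have hc (n : ℤ) (x : ℓ) : superBracket K (Op K ℓ) false true X (cOp n (φ x)) = 0 := by
    have hX' : superBracket K (Op K ℓ) false true X (cOp n (φ x)) =
        superBracket K (Op K ℓ) true false (diffOp B) (βOp n x) +
          superBracket K (Op K ℓ) true false (tOp B φ)
            (superBracket K (Op K ℓ) true true (diffOp B) (cOp n (φ x))) := by
      rw [← hX]
      simp [superBracket_jacobi, tOp_c]
    refine (hXw.superBracket (hasWeight_c B n (φ x)) _ _ (zero_add n)).eq_zero (p := true)
      (forall_mode_of_equiv φ ?_ ?_ ?_ ?_) ?_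
    · exact fun k y => superBracket_superBracket_op_eq_zero (.c n (φ x)) (.b k y) rfl (hb _ _)
    · intro m y
      rw [hX', map_add, LinearMap.add_apply, diffOp_β_c,
        superBracket_jacobi (K := K) true false true (Bool.xor_false true), diffOp_c_c, tOp_c]
      simp [diffOp_c_β]
    · exact fun k y => superBracket_superBracket_op_eq_zero (.c n (φ x)) (.β k y) rfl (hβ _ _)
    · intro m y
      rw [hX', map_add, LinearMap.add_apply, diffOp_β_γ,
        superBracket_jacobi (K := K) true false false (Bool.xor_false true), diffOp_c_γ,
        tOp_γ B φ hφ, hφ']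
      simp [diffOp_c_b, hφ', e x y, -lie_skew]
    -- `c_0` does not kill the vacuum, so the two summands of `hX'` are evaluated there separately.
    · rintro rfl
      rw [hX', LinearMap.add_apply, superBracket_vac (diffOp_vac B) (βOp_zero_vac x),
        superBracket_even_right, LinearMap.sub_apply, Module.End.mul_apply, Module.End.mul_apply,
        tOp_vac, map_zero, tOp_comp_diffOp_c_vac, sub_zero, add_zero]
  have hγ (n : ℤ) (x : ℓ) : superBracket K (Op K ℓ) false false X (γOp n (φ x)) = 0 := by
    have hX' : superBracket K (Op K ℓ) false false X (γOp n (φ x)) =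
        (-1 : K) • thetaOp B x n + superBracket K (Op K ℓ) true true (tOp B φ)
          (superBracket K (Op K ℓ) true false (diffOp B) (γOp n (φ x))) := by
      rw [← hX]
      simp [superBracket_jacobi, tOp_γ B φ hφ, diffOp_b]
    refine (hXw.superBracket (hasWeight_γ B n (φ x)) _ _ (zero_add n)).eq_zero (p := false)
      (forall_mode_of_equiv φ ?_ ?_ ?_ ?_) ?_
    · exact fun k y => superBracket_superBracket_op_eq_zero (.γ n (φ x)) (.b k y) rfl (hb _ _)
    · exact fun k y => superBracket_superBracket_op_eq_zero (.γ n (φ x)) (.c k (φ y)) rfl (hc _ _)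
    · exact fun k y => superBracket_superBracket_op_eq_zero (.γ n (φ x)) (.β k y) rfl (hβ _ _)
    · intro m y
      rw [hX', map_add, LinearMap.add_apply, map_smul, LinearMap.smul_apply, thetaOp_γ,
        superBracket_jacobi (K := K) true true false (Bool.xor_self true), diffOp_γ_γ,
        tOp_γ B φ hφ, hφ']
      simp [diffOp_γ_b, hφ', e x y, -lie_skew]
    · rintro rfl
      rw [hX', LinearMap.add_apply, LinearMap.smul_apply, thetaOp_vac, superBracket_odd,
        LinearMap.add_apply, Module.End.mul_apply, Module.End.mul_apply, tOp_vac, map_zero,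
        tOp_comp_diffOp_γ_vac B φ hφ]
      simp
  rw [hX]
  exact eq_zero_of_superBracket (forall_mode_of_equiv φ hb hc hβ hγ) hX0

end Differential

/-! ### Symmetry and invariance of the Killing form; parity of superdegrees. -/

section Killing

theorem killingIso_symm {K ℓ : Type*} [Field K] [CharZero K] [LieRing ℓ] [LieAlgebra K ℓ]
    [FiniteDimensional K ℓ] [LieAlgebra.HasTrivialRadical K ℓ] (a : Kˣ) (x y : ℓ) :
    killingIso K ℓ a x y = killingIso K ℓ a y x :=
  congrArg ((a : K) • ·) (LieModule.traceForm_comm K ℓ ℓ x y)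

/-- Invariance of the trace form, `κ(x, ⁅y, z⁆) = κ(⁅x, y⁆, z)`, which a scalar multiple inherits.
-/
theorem killingIso_comp_ad {K ℓ : Type*} [Field K] [CharZero K] [LieRing ℓ] [LieAlgebra K ℓ]
    [FiniteDimensional K ℓ] [LieAlgebra.HasTrivialRadical K ℓ] (a : Kˣ) (x y : ℓ) :
    killingIso K ℓ a x ∘ₗ (LieAlgebra.ad K ℓ y : ℓ →ₗ[K] ℓ) = killingIso K ℓ a ⁅x, y⁆ :=
  LinearMap.ext fun z =>
    congrArg ((a : K) • ·) (LieModule.traceForm_apply_lie_apply K ℓ ℓ x y z).symm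

theorem superComm_eq {K ℓ : Type*} [Field K] [LieRing ℓ] [LieAlgebra K ℓ] {p q : ℤ} {s t : Bool}
    (hp : decide (Odd p) = s) (hq : decide (Odd q) = t) (X Y : Op K ℓ) :
    superComm p q X Y = superBracket K (Op K ℓ) s t X Y := by
  subst hp hq
  by_cases h₁ : Odd p <;> by_cases h₂ : Odd q <;>
    simp [superComm, h₁, h₂, superBracket_odd, superBracket_even_left, superBracket_even_right]

end Killing

end VOWA

end

/-! ### The main theorem. -/

theorem proposition5 {K : Type*} [Field K] [IsAlgClosed K] [CharZero K]
    {ℓ : Type*} [LieRing ℓ] [LieAlgebra K ℓ] [FiniteDimensional K ℓ]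
    [LieAlgebra.HasTrivialRadical K ℓ]
    {ι : Type*} [Fintype ι] (B : Module.Basis ι K ℓ)
    (a : Kˣ) (φ : ℓ ≃ₗ[K] Module.Dual K ℓ) (hφ : φ = VOWA.killingIso K ℓ a)
    (Q h k r t : VOWA.Op K ℓ) (θ : ℓ → ℤ → VOWA.Op K ℓ) (L : ℤ → VOWA.Op K ℓ)
    (hQ : Q = VOWA.diffOp B) (hh : h = VOWA.koszulOp B) (hk : k = VOWA.homotopyOp B)
    (hr : r = VOWA.rOp B φ) (ht : t = VOWA.tOp B φ)
    (hθ : θ = VOWA.thetaOp B) (hL : L = VOWA.virOp B) :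
    -- all the infinite sums are well defined
    (VOWA.LocallyFinite (VOWA.rTerm B φ) ∧ VOWA.LocallyFinite (VOWA.tTerm B φ) ∧
      VOWA.LocallyFinite (VOWA.diffTerm B) ∧ VOWA.LocallyFinite (VOWA.koszulTerm B) ∧
      VOWA.LocallyFinite (VOWA.homotopyTerm B) ∧
      (∀ u n, VOWA.LocallyFinite (VOWA.thetaTerm B u n)) ∧
      (∀ n, VOWA.LocallyFinite (VOWA.virTerm B n))) ∧
    (r * r = 0 ∧ t * t = 0) ∧
    VOWA.superComm 1 (-1) r t = -L 0 ∧
    (VOWA.superComm 1 1 Q r = 0 ∧ VOWA.superComm 1 (-1) Q t = 0) ∧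
    (VOWA.superComm 1 (-1) r h = 0 ∧ VOWA.superComm 1 1 r k = 0 ∧
      VOWA.superComm (-1) (-1) t h = 0 ∧ VOWA.superComm (-1) 1 t k = 0) ∧
    (∀ u n, VOWA.superComm (-1) 0 t (θ u n) = 0) ∧
    (∀ u, VOWA.superComm 1 0 r (θ u 0) = 0) ∧
    (∀ n, VOWA.superComm 1 0 r (L n) = 0) ∧
    VOWA.superComm (-1) 0 t (L 0) = 0 := by
  have hs : ∀ x y, φ x y = φ y x := hφ ▸ VOWA.killingIso_symm a
  have hi : ∀ x y, φ x ∘ₗ (LieAlgebra.ad K ℓ y : ℓ →ₗ[K] ℓ) = φ ⁅x, y⁆ :=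
    hφ ▸ VOWA.killingIso_comp_ad a
  have h₁ : decide (Odd (1 : ℤ)) = true := by decide
  have h₂ : decide (Odd (-1 : ℤ)) = true := by decide
  have h₀ : decide (Odd (0 : ℤ)) = false := by decide
  -- For odd `X` the supercommutator with itself is `2 X²`, and `2` is invertible.
  have sq (X : VOWA.Op K ℓ) (hX : VOWA.superBracket K (VOWA.Op K ℓ) true true X X = 0) :
      X * X = 0 := by
    rw [VOWA.superBracket_odd, ← two_smul K] at hX
    exact (smul_eq_zero.1 hX).resolve_left two_ne_zero
  subst hQ hh hk hr ht hθ hL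
  simp only [VOWA.superComm_eq h₁ h₁, VOWA.superComm_eq h₁ h₂, VOWA.superComm_eq h₂ h₁,
    VOWA.superComm_eq h₂ h₂, VOWA.superComm_eq h₁ h₀, VOWA.superComm_eq h₂ h₀]
  exact ⟨⟨VOWA.locallyFinite_rTerm B φ, VOWA.locallyFinite_tTerm B φ,
      VOWA.locallyFinite_diffTerm B, VOWA.locallyFinite_koszulTerm B,
      VOWA.locallyFinite_homotopyTerm B,
      fun x n => VOWA.thetaTerm_eq B x n ▸ VOWA.locallyFinite_gradTerm B _ _ n,
      fun n => VOWA.virTerm_eq B n ▸ VOWA.locallyFinite_gradTerm B _ _ n⟩,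
    ⟨sq _ (VOWA.rOp_rOp B φ hs), sq _ (VOWA.tOp_tOp B φ hs)⟩,
    eq_neg_of_add_eq_zero_left (VOWA.rOp_tOp B φ hs),
    ⟨VOWA.diffOp_rOp B φ hs hi, VOWA.diffOp_tOp B φ hs hi⟩,
    ⟨VOWA.rOp_koszulOp B φ hs, VOWA.rOp_homotopyOp B φ hs, VOWA.tOp_koszulOp B φ hs,
      VOWA.tOp_homotopyOp B φ hs⟩,
    VOWA.tOp_thetaOp B φ hs hi, VOWA.rOp_thetaOp B φ hs hi, VOWA.rOp_virOp B φ hs,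
    VOWA.tOp_virOp B φ hs⟩
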